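/- **Theorem 6.1 (weak Nullstellensatz for supersymmetric polynomials).** Let $k$ be an algebraically closed field of characteristic zero and let $m,n\ge 0$ be integers. The group $S_m\times S_n$ acts on the polynomial ring $k[x_1,\dots,x_m,y_1,\dots,y_n]$ and on the Laurent polynomial ring $k[x_1^{\pm1},\dots,x_m^{\pm1},y_1^{\pm1},\dots,y_n^{\pm1}]$ by permuting the $x_i$ and the $y_j$ separately. *Case S.* Let $A$ be the $k$-algebra of supersymmetric polynomials, that is, of the $S_m\times S_n$-invariant polynomials $f\in k[x_1,\dots,x_m,y_1,\dots,y_n]$ such that, for all $1\le i\le m$ and $1\le j\le n$, the result of substituting $x_i=t$, $y_j=-t$ in $f$ does not depend on $t$. Then for every maximal ideal $M$ of $A$ there is a point $\lambda\in k^{m}\times k^{n}$ such that $M=\{f\in A : f(\lambda)=0\}$. *Case L.* Let $A$ be the $k$-algebra of supersymmetric Laurent polynomials, that is, of the $S_m\times S_n$-invariant Laurent polynomials $f\in k[x_1^{\pm1},\dots,x_m^{\pm1},y_1^{\pm1},\dots,y_n^{\pm1}]$ such that $$x_i\frac{\partial f}{\partial x_i}+y_j\frac{\partial f}{\partial y_j}\in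 (x_i-y_j)\qquad\text{for all } 1\le i\le m,\ 1\le j\le n .$$ Then for every maximal ideal $M$ of $A$ there is a point $\lambda\in (k^*)^{m}\times (k^*)^{n}$ such that $M=\{f\in A : f(\lambda)=0\}$. -/

import Mathlib

namespace Supersymmetric

/-- The simultaneous permutation of `x₁, …, x_m` by `σ` and of `y₁, …, y_n` by `τ`.
The index `Sum.inl i` stands for `xᵢ`, the index `Sum.inr j` for `yⱼ`. -/
def perm {m n : ℕ} (σ : Equiv.Perm (Fin m)) (τ : Equiv.Perm (Fin n)) :
    Fin m ⊕ Fin n → Fin m ⊕ Fin n :=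
  Sum.map σ τ

/-! ### Supersymmetric polynomials -/

/-- The polynomial ring `R[x₁, …, x_m, y₁, …, y_n]`. -/
abbrev PolyRing (R : Type*) [CommRing R] (m n : ℕ) : Type _ :=
  MvPolynomial (Fin m ⊕ Fin n) R

/-- The substitution `f ↦ f(xᵢ = t, yⱼ = -t)`, with values in `R[x₁, …, x_m, y₁, …, y_n][t]`;
all variables other than `xᵢ` and `yⱼ` are kept. -/
noncomputable def subst (R : Type*) [CommRing R] {m n : ℕ} (i : Fin m) (j : Fin n) :
    PolyRing R m n →ₐ[R] Polynomial (PolyRing R m n) :=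
  MvPolynomial.aeval (Sum.elim
    (fun a => if a = i then Polynomial.X else Polynomial.C (MvPolynomial.X (Sum.inl a)))
    (fun b => if b = j then -Polynomial.X else Polynomial.C (MvPolynomial.X (Sum.inr b))))

/-- The `R`-algebra of supersymmetric polynomials in `x₁, …, x_m | y₁, …, y_n`: the polynomials
`f` that are invariant under `S_m × S_n` and for which `f(xᵢ = t, yⱼ = -t)` is independent of `t`.
By invariance the second condition for one pair `(i, j)`, such as the pair of first indices,
is the same as the condition for all pairs. -/
noncomputable def superPoly (R : Type*) [CommRing R] (m n : ℕ) :
    Subalgebra R (PolyRing R m n) where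
  carrier := {f |
    (∀ (σ : Equiv.Perm (Fin m)) (τ : Equiv.Perm (Fin n)),
      MvPolynomial.rename (perm σ τ) f = f) ∧
    ∀ (i : Fin m) (j : Fin n), ∃ g : PolyRing R m n, subst R i j f = Polynomial.C g}
  mul_mem' := by
    rintro f g ⟨hf, hf'⟩ ⟨hg, hg'⟩
    refine ⟨fun σ τ => by rw [map_mul, hf, hg], fun i j => ?_⟩
    obtain ⟨a, ha⟩ := hf' i j
    obtain ⟨b, hb⟩ := hg' i j
    exact ⟨a * b, by rw [map_mul, map_mul, ha, hb]⟩
  add_mem' := by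
    rintro f g ⟨hf, hf'⟩ ⟨hg, hg'⟩
    refine ⟨fun σ τ => by rw [map_add, hf, hg], fun i j => ?_⟩
    obtain ⟨a, ha⟩ := hf' i j
    obtain ⟨b, hb⟩ := hg' i j
    exact ⟨a + b, by rw [map_add, map_add, ha, hb]⟩
  algebraMap_mem' r :=
    ⟨fun σ τ => by rw [AlgHom.commutes],
      fun i j => ⟨algebraMap R _ r, by rw [AlgHom.commutes]; rfl⟩⟩

/-- The value `f(p)` of a polynomial `f` at a point `p` of `R^m × R^n`. -/
noncomputable def evalPoly {R : Type*} [CommRing R] {m n : ℕ} (p : (Fin m → R) × (Fin n → R)) :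
    PolyRing R m n →ₐ[R] R :=
  MvPolynomial.aeval (Sum.elim p.1 p.2)

/-! ### Supersymmetric Laurent polynomials -/

/-- The Laurent polynomial ring `R[x₁^±¹, …, x_m^±¹, y₁^±¹, …, y_n^±¹]`, as the algebra of the
additive group of exponents. -/
abbrev LaurentRing (R : Type*) [CommRing R] (m n : ℕ) : Type _ :=
  AddMonoidAlgebra R (Fin m ⊕ Fin n →₀ ℤ)

/-- The variable of the Laurent polynomial ring with index `v`. -/
noncomputable def laurentVar (R : Type*) [CommRing R] {m n : ℕ} (v : Fin m ⊕ Fin n) :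
    LaurentRing R m n :=
  AddMonoidAlgebra.single (Finsupp.single v 1) 1

/-- The action of a pair of permutations on Laurent polynomials,
the variable with index `v` going to the one with index `perm σ τ v`. -/
noncomputable def laurentPerm (R : Type*) [CommRing R] {m n : ℕ}
    (σ : Equiv.Perm (Fin m)) (τ : Equiv.Perm (Fin n)) :
    LaurentRing R m n →ₐ[R] LaurentRing R m n :=
  AddMonoidAlgebra.mapDomainAlgHom R R (Finsupp.mapDomain.addMonoidHom (perm σ τ))

/-- The operator `z ∂/∂z` on Laurent polynomials for the variable `z` with index `v`,
as a linear map: it multiplies the monomial with exponent `a` by the integer `a v`. -/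
noncomputable def eulerLin (R : Type*) [CommRing R] {m n : ℕ} (v : Fin m ⊕ Fin n) :
    LaurentRing R m n →ₗ[R] LaurentRing R m n where
  toFun f := f.coeff.sum fun a c => AddMonoidAlgebra.single a ((a v : R) * c)
  map_add' f g := by
    rw [AddMonoidAlgebra.coeff_add]
    refine Finsupp.sum_add_index' (fun a => ?_) (fun a c d => ?_)
    · rw [mul_zero, AddMonoidAlgebra.single_zero]
    · rw [mul_add, AddMonoidAlgebra.single_add]
  map_smul' r f := by
    rw [AddMonoidAlgebra.coeff_smul, Finsupp.sum_smul_index (by simp), Finsupp.smul_sum]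
    refine Finset.sum_congr rfl fun a _ => ?_
    simp only [AddMonoidAlgebra.smul_single, smul_eq_mul, RingHom.id_apply]
    rw [mul_left_comm]

theorem eulerLin_single (R : Type*) [CommRing R] {m n : ℕ} (v : Fin m ⊕ Fin n)
    (a : Fin m ⊕ Fin n →₀ ℤ) (c : R) :
    eulerLin R v (AddMonoidAlgebra.single a c) = AddMonoidAlgebra.single a ((a v : R) * c) := by
  change (AddMonoidAlgebra.single a c).coeff.sum
    (fun b d => (AddMonoidAlgebra.single b ((b v : R) * d) : LaurentRing R m n)) = _
  rw [AddMonoidAlgebra.coeff_single]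
  exact Finsupp.sum_single_index (by simp)

theorem eulerLin_mul (R : Type*) [CommRing R] {m n : ℕ} (v : Fin m ⊕ Fin n)
    (f g : LaurentRing R m n) :
    eulerLin R v (f * g) = f * eulerLin R v g + g * eulerLin R v f := by
  induction f using AddMonoidAlgebra.induction_linear with
  | zero => simp
  | add f₁ f₂ h₁ h₂ => rw [add_mul, map_add, map_add, h₁, h₂]; ring
  | single a r =>
    induction g using AddMonoidAlgebra.induction_linear with
    | zero => simp
    | add g₁ g₂ h₁ h₂ => rw [mul_add, map_add, map_add, h₁, h₂]; ring
    | single b s =>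
      rw [AddMonoidAlgebra.single_mul_single, eulerLin_single, eulerLin_single, eulerLin_single,
        AddMonoidAlgebra.single_mul_single, AddMonoidAlgebra.single_mul_single, add_comm b a,
        ← AddMonoidAlgebra.single_add]
      congr 1
      rw [Finsupp.add_apply]
      push_cast
      ring

/-- The derivation `z ∂/∂z` of the Laurent polynomial ring, for the variable `z` with index `v`. -/
noncomputable def euler (R : Type*) [CommRing R] {m n : ℕ} (v : Fin m ⊕ Fin n) :
    Derivation R (LaurentRing R m n) (LaurentRing R m n) :=
  Derivation.mk' (eulerLin R v) (eulerLin_mul R v)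

/-- The `R`-algebra of supersymmetric Laurent polynomials: the Laurent polynomials `f` that are
invariant under `S_m × S_n` and satisfy `xᵢ ∂f/∂xᵢ + yⱼ ∂f/∂yⱼ ∈ (xᵢ - yⱼ)` for all `i`, `j`. -/
noncomputable def superLaurent (R : Type*) [CommRing R] (m n : ℕ) :
    Subalgebra R (LaurentRing R m n) where
  carrier := {f |
    (∀ (σ : Equiv.Perm (Fin m)) (τ : Equiv.Perm (Fin n)), laurentPerm R σ τ f = f) ∧
    ∀ (i : Fin m) (j : Fin n),
      euler R (Sum.inl i) f + euler R (Sum.inr j) f ∈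
        Ideal.span {laurentVar R (Sum.inl i) - laurentVar R (Sum.inr j)}}
  mul_mem' := by
    rintro f g ⟨hf, hf'⟩ ⟨hg, hg'⟩
    refine ⟨fun σ τ => by rw [map_mul, hf, hg], fun i j => ?_⟩
    have h := Ideal.add_mem _ (Ideal.mul_mem_left _ f (hg' i j))
      (Ideal.mul_mem_left _ g (hf' i j))
    rw [Derivation.leibniz, Derivation.leibniz]
    simp only [smul_eq_mul]
    convert h using 1
    ring
  add_mem' := by
    rintro f g ⟨hf, hf'⟩ ⟨hg, hg'⟩
    refine ⟨fun σ τ => by rw [map_add, hf, hg], fun i j => ?_⟩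
    have h := Ideal.add_mem _ (hf' i j) (hg' i j)
    rw [map_add, map_add]
    convert h using 1
    ring
  algebraMap_mem' r :=
    ⟨fun σ τ => by rw [AlgHom.commutes],
      fun i j => by rw [Derivation.map_algebraMap, Derivation.map_algebraMap, add_zero]
                    exact Ideal.zero_mem _⟩

/-- The value `f(p)` of a Laurent polynomial `f` at a point `p` of `(Rˣ)^m × (Rˣ)^n`: the monomial
with exponent `a` is sent to the product of the integer powers `p_v ^ (a v)`. -/
noncomputable def evalLaurent {R : Type*} [CommRing R] {m n : ℕ}
    (p : (Fin m → Rˣ) × (Fin n → Rˣ)) : LaurentRing R m n →ₐ[R] R :=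
  AddMonoidAlgebra.lift R R (Fin m ⊕ Fin n →₀ ℤ)
    { toFun := fun a => ((∏ v, (Sum.elim p.1 p.2 v) ^ (a.toAdd v) : Rˣ) : R)
      map_one' := by simp
      map_mul' := fun a b => by
        simp [zpow_add, Finset.prod_mul_distrib] }

end Supersymmetric

namespace Supersymmetric

open Function

/-! Both cases are one statement about functions on `X^(m+n)`, where `X` is the affine line or the
punctured line. In case S the sign of the `y_j` is changed, so that the condition concerns the
diagonals `x_i = y_j`. In case L the differential condition says that `f` is constant in the common
value of `x_i = y_j` (`euler_mem_span_iff`). Let `A` be the resulting algebra `superFun`.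

The stratum of level `s` is given by `x_i = y_i` for the first `s` indices. On it an element of `A`
ignores these coordinates, so its restriction may be computed after `collapse`, which puts `x₀` in
their place. The ideals of functions in `A` vanishing on the strata increase with `s`, starting from
zero. For a maximal ideal `M` there is thus a last level `s` whose ideal lies in `M`. Unless this is
the final level, some `f₀` outside `M` vanishes on the next stratum, and on level `s` it equals
`highRes * b`, where `highRes` is the product of the remaining `x_a - y_b` (`exists_stratum`).

Conversely, every `highRes * g` with `g` an invariant function on the stratum extends to an element
of `A` (`exists_superFun_collapse`). The extension is the average of `weight * g` over `S_m × S_n`.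
The weight equals `highRes` on the stratum, it vanishes on `x_i = y_j` unless both indices are low,
and when both are low it does not see the common value. Its poles lie on the diagonals within each
set of variables, and they cancel because an alternating function is divisible by the Vandermonde
products.

Hence `g ↦ [extension of highRes * b * g] / [f₀]` is a ring homomorphism `ψ` to `A / M` from all
regular functions invariant under the permutations that preserve the low indices, and it extends the
quotient map of `A`. The ring of regular functions is integral over these invariants, so a maximal
ideal lies over the kernel of `ψ`. Hilbert's Nullstellensatz turns that ideal into a point. -/

/-- The algebra of functions on `X^σ` that is generated by the functions `p ↦ r (p v)` with `r` in
a given set of functions on `X`. -/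
def regular {k X : Type*} [Field k] (gens : Set (X → k)) (σ : Type*) :
    Subalgebra k ((σ → X) → k) :=
  Algebra.adjoin k {f | ∃ v, ∃ r ∈ gens, f = fun p => r (p v)}

/-- A set `X` with a finitely generated algebra of `k`-valued functions that behaves like the affine
line or the punctured affine line with its coordinate. -/
structure LineModel (k X : Type*) [Field k] where
  /-- the coordinate -/
  coord : X → k
  /-- generators of the algebra of functions -/
  gens : Set (X → k)
  coord_injective : Injective coord
  coord_mem_gens : coord ∈ gens
  finite_gens : gens.Finite
  finite_zeros : ∀ r ∈ Algebra.adjoin k gens, ∀ x, r x ≠ 0 → {y | r y = 0}.Finite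
  exists_point : ∀ χ : Algebra.adjoin k gens →ₐ[k] k, ∃ x, ∀ (r : X → k) (hr : r ∈ gens),
    χ ⟨r, Algebra.subset_adjoin hr⟩ = r x
  divided_difference : ∀ r ∈ gens, ∃ q ∈ regular gens Bool, ∀ x y,
    r x - r y = (coord x - coord y) * q (fun b => cond b x y)

/-- A map between powers of `X` each of whose components is a projection or a constant. -/
def IsCoordMap {X σ τ : Type*} (θ : (σ → X) → (τ → X)) : Prop :=
  ∀ v, (∃ w, ∀ p, θ p v = p w) ∨ ∃ x, ∀ p, θ p v = x

/-! ### Regular functions on powers of the line: density and divisibility by diagonals. -/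

namespace LineModel

variable {k X : Type*} [Field k] (L : LineModel k X) {σ τ : Type*}

/-- The value of the coordinate `v` minus the value of the coordinate `w`. -/
def diff (p : σ → X) (v w : σ) : k := L.coord (p v) - L.coord (p w)

theorem gen_mem {r : X → k} (hr : r ∈ L.gens) (v : σ) :
    (fun p : σ → X => r (p v)) ∈ regular L.gens σ :=
  Algebra.subset_adjoin ⟨v, r, hr, rfl⟩

theorem coord_mem (v : σ) : (fun p : σ → X => L.coord (p v)) ∈ regular L.gens σ :=
  L.gen_mem L.coord_mem_gens v

theorem const_mem (c : k) : (fun _ : σ → X => c) ∈ regular L.gens σ :=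
  Subalgebra.algebraMap_mem _ c

theorem diff_mem (v w : σ) : (fun p : σ → X => L.diff p v w) ∈ regular L.gens σ :=
  sub_mem (L.coord_mem v) (L.coord_mem w)

theorem prod_mem {ι : Type*} (s : Finset ι) {f : ι → (σ → X) → k}
    (h : ∀ i ∈ s, f i ∈ regular L.gens σ) :
    (fun p => ∏ i ∈ s, f i p) ∈ regular L.gens σ := by
  have := Subalgebra.prod_mem _ h
  convert this using 1
  ext p
  simp

theorem sum_mem {ι : Type*} (s : Finset ι) {f : ι → (σ → X) → k}
    (h : ∀ i ∈ s, f i ∈ regular L.gens σ) :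
    (fun p => ∑ i ∈ s, f i p) ∈ regular L.gens σ := by
  have := Subalgebra.sum_mem _ h
  convert this using 1
  ext p
  simp

theorem ite_mem {c : Prop} [Decidable c] {f g : (σ → X) → k} (hf : f ∈ regular L.gens σ)
    (hg : g ∈ regular L.gens σ) : (fun p => if c then f p else g p) ∈ regular L.gens σ := by
  split_ifs
  exacts [hf, hg]

theorem comp_mem {θ : (σ → X) → (τ → X)} (hθ : IsCoordMap θ) {f : (τ → X) → k}
    (hf : f ∈ regular L.gens τ) : (fun p => f (θ p)) ∈ regular L.gens σ := by
  induction hf using Algebra.adjoin_induction with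
  | mem f h =>
    obtain ⟨v, r, hr, rfl⟩ := h
    rcases hθ v with ⟨w, h⟩ | ⟨x, h⟩
    · simp only [h]
      exact L.gen_mem hr w
    · simp only [h]
      exact L.const_mem _
  | algebraMap c => exact L.const_mem c
  | add f g _ _ hf hg => exact add_mem hf hg
  | mul f g _ _ hf hg => exact mul_mem hf hg

theorem isCoordMap_reindex (e : τ → σ) : IsCoordMap fun (p : σ → X) => p ∘ e :=
  fun v => Or.inl ⟨e v, fun _ => rfl⟩

theorem isCoordMap_update [DecidableEq σ] (v w : σ) :
    IsCoordMap fun p : σ → X => update p v (p w) := by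
  intro u
  by_cases h : u = v
  · exact Or.inl ⟨w, fun p => by simp [h]⟩
  · exact Or.inl ⟨u, fun p => by simp [h]⟩

theorem update_mem_adjoin [DecidableEq σ] {f : (σ → X) → k} (hf : f ∈ regular L.gens σ)
    (p : σ → X) (v : σ) : (fun x => f (update p v x)) ∈ Algebra.adjoin k L.gens := by
  induction hf using Algebra.adjoin_induction with
  | mem f h =>
    obtain ⟨w, r, hr, rfl⟩ := h
    by_cases hw : w = v
    · subst hw
      simpa using Algebra.subset_adjoin hr
    · simp only [update_of_ne hw]
      exact Subalgebra.algebraMap_mem _ (r (p w))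
  | algebraMap c => exact Subalgebra.algebraMap_mem _ c
  | add f g _ _ hf hg => exact add_mem hf hg
  | mul f g _ _ hf hg => exact mul_mem hf hg

/-- Two nonzero regular functions have a common point where they do not vanish. -/
theorem exists_ne_zero [Infinite X] [Finite σ] {f g : (σ → X) → k}
    (hf : f ∈ regular L.gens σ) (hg : g ∈ regular L.gens σ) {p q : σ → X}
    (hp : f p ≠ 0) (hq : g q ≠ 0) : ∃ r, f r ≠ 0 ∧ g r ≠ 0 := by
  classical
  -- Induction on a set containing the coordinates where `p` and `q` differ. One such coordinate is
  -- given the same new value in both points, outside the finitely many zeros of the two functions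
  -- of that coordinate.
  have key : ∀ (s : Finset σ) (p q : σ → X), f p ≠ 0 → g q ≠ 0 → (∀ v ∉ s, p v = q v) →
      ∃ r, f r ≠ 0 ∧ g r ≠ 0 := by
    intro s
    induction s using Finset.induction_on with
    | empty =>
      intro p q hp hq h
      obtain rfl : p = q := funext fun v => h v (by simp)
      exact ⟨p, hp, hq⟩
    | insert v s hv ih =>
      intro p q hp hq h
      have h1 := L.finite_zeros _ (L.update_mem_adjoin hf p v) (p v) (by simpa using hp)
      have h2 := L.finite_zeros _ (L.update_mem_adjoin hg q v) (q v) (by simpa using hq)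
      obtain ⟨x, hx⟩ := (h1.union h2).exists_notMem
      simp only [Set.mem_union, Set.mem_ofPred_eq, not_or] at hx
      refine ih _ _ hx.1 hx.2 fun w hw => ?_
      by_cases hwv : w = v
      · simp [hwv]
      · rw [update_of_ne hwv, update_of_ne hwv]
        exact h w (by simp [hwv, hw])
  cases nonempty_fintype σ
  exact key Finset.univ p q hp hq (by simp)

/-- Density principle: an identity of regular functions need only be checked off the zeros of a
nonzero one. It is what extends computations at generic points to all points. -/
theorem eq_zero_of_mul [Infinite X] [Finite σ] {f g : (σ → X) → k}
    (hf : f ∈ regular L.gens σ) (hg : g ∈ regular L.gens σ) {q : σ → X} (hq : g q ≠ 0)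
    (h : ∀ p, g p ≠ 0 → f p = 0) (p : σ → X) : f p = 0 := by
  by_contra hp
  obtain ⟨r, h1, h2⟩ := L.exists_ne_zero hf hg hp hq
  exact h1 (h r h2)

/-- Divided differences exist for the generators and propagate to products by `fg - f'g' = (f - f')g
+ f'(g - g')`. -/
theorem exists_sub_update_eq [DecidableEq σ] {f : (σ → X) → k} (hf : f ∈ regular L.gens σ)
    (v w : σ) : ∃ g ∈ regular L.gens σ, ∀ p,
      f p - f (update p v (p w)) = L.diff p v w * g p := by
  induction hf using Algebra.adjoin_induction with
  | mem f h =>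
    obtain ⟨u, r, hr, rfl⟩ := h
    by_cases hu : u = v
    · subst hu
      obtain ⟨q, hq, h⟩ := L.divided_difference r hr
      refine ⟨fun p => q (fun b => cond b (p u) (p w)), L.comp_mem (fun b => ?_) hq,
        fun p => by simp [h, diff]⟩
      cases b
      · exact Or.inl ⟨w, fun _ => rfl⟩
      · exact Or.inl ⟨u, fun _ => rfl⟩
    · exact ⟨0, zero_mem _, fun p => by simp [hu]⟩
  | algebraMap c => exact ⟨0, zero_mem _, fun p => by simp [Pi.algebraMap_apply]⟩
  | add f g _ _ hf hg =>
    obtain ⟨a, ha, ha'⟩ := hf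
    obtain ⟨b, hb, hb'⟩ := hg
    refine ⟨_, add_mem ha hb, fun p => ?_⟩
    simp only [Pi.add_apply]
    linear_combination ha' p + hb' p
  | mul f g _ hg' hf hg =>
    rename_i hf'
    obtain ⟨a, ha, ha'⟩ := hf
    obtain ⟨b, hb, hb'⟩ := hg
    refine ⟨_, add_mem (mul_mem ha hg')
      (mul_mem (L.comp_mem (isCoordMap_update v w) hf') hb), fun p => ?_⟩
    simp only [Pi.add_apply, Pi.mul_apply]
    linear_combination g p * ha' p + f (update p v (p w)) * hb' p

theorem exists_eq_diff_mul {f : (σ → X) → k} (hf : f ∈ regular L.gens σ) (v w : σ)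
    (h : ∀ p : σ → X, p v = p w → f p = 0) :
    ∃ g ∈ regular L.gens σ, ∀ p, f p = L.diff p v w * g p := by
  classical
  obtain ⟨g, hg, hfg⟩ := L.exists_sub_update_eq hf v w
  refine ⟨g, hg, fun p => ?_⟩
  rw [← hfg, h (update p v (p w)), sub_zero]
  by_cases hv : w = v
  · simp [hv]
  · simp [hv]

theorem exists_diff_ne_zero [Infinite X] [Finite σ] {v w : σ} (h : v ≠ w) :
    ∃ p : σ → X, L.diff p v w ≠ 0 := by
  classical
  obtain ⟨x, y, hxy⟩ := exists_pair_ne X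
  refine ⟨fun u => if u = v then x else y, ?_⟩
  simp only [diff, if_true, if_neg h.symm]
  exact sub_ne_zero.2 fun e => hxy (L.coord_injective e)

theorem exists_prod_ne_zero [Infinite X] [Finite σ] {ι : Type*} (E : Finset ι)
    {f : ι → (σ → X) → k} (hf : ∀ i ∈ E, f i ∈ regular L.gens σ)
    (h : ∀ i ∈ E, ∃ p, f i p ≠ 0) : ∃ p, ∏ i ∈ E, f i p ≠ 0 := by
  classical
  induction E using Finset.induction_on with
  | empty =>
    obtain ⟨x⟩ : Nonempty X := inferInstance
    exact ⟨fun _ => x, by simp⟩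
  | insert a s ha ih =>
    obtain ⟨p, hp⟩ := ih (fun i hi => hf i (by simp [hi])) (fun i hi => h i (by simp [hi]))
    obtain ⟨q, hq⟩ := h a (by simp)
    obtain ⟨r, h1, h2⟩ := L.exists_ne_zero (hf a (by simp))
      (L.prod_mem s fun i hi => hf i (by simp [hi])) hq hp
    exact ⟨r, by rw [Finset.prod_insert ha]; exact mul_ne_zero h1 h2⟩

/-- A regular function that vanishes on several distinct diagonals `p v = p w` is divisible by the
product of their equations. -/
theorem exists_eq_prod_diff_mul [Infinite X] [Finite σ] {ι : Type*} (E : Finset ι) (a b : ι → σ)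
    (hab : ∀ i ∈ E, a i ≠ b i)
    (hE : ∀ i ∈ E, ∀ j ∈ E, i ≠ j → ¬(a i = a j ∧ b i = b j) ∧ ¬(a i = b j ∧ b i = a j))
    {f : (σ → X) → k} (hf : f ∈ regular L.gens σ)
    (h : ∀ i ∈ E, ∀ p : σ → X, p (a i) = p (b i) → f p = 0) :
    ∃ g ∈ regular L.gens σ, ∀ p, f p = (∏ i ∈ E, L.diff p (a i) (b i)) * g p := by
  classical
  induction E using Finset.induction_on with
  | empty => exact ⟨f, hf, by simp⟩
  | insert i s hi ih =>
    obtain ⟨g, hg, hfg⟩ := ih (fun j hj => hab j (by simp [hj]))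
      (fun j hj l hl => hE j (by simp [hj]) l (by simp [hl])) (fun j hj => h j (by simp [hj]))
    have hi' := hab i (by simp)
    set θ : (σ → X) → (σ → X) := fun p => update p (a i) (p (b i)) with hθ
    have hθm : IsCoordMap θ := isCoordMap_update _ _
    -- The diagonals are distinct, so the product of the earlier equations is not identically zero
    -- on the new one. By density the cofactor `g` vanishes there and can be divided once more.
    have hprod : ∃ p, ∏ j ∈ s, L.diff (θ p) (a j) (b j) ≠ 0 := by
      refine L.exists_prod_ne_zero s (f := fun j p => L.diff (θ p) (a j) (b j))
        (fun j _ => L.comp_mem hθm (L.diff_mem _ _)) fun j hj => ?_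
      have hij := hE i (by simp) j (by simp [hj]) (fun e => hi (e ▸ hj))
      have hj' := hab j (by simp [hj])
      by_cases h1 : a j = a i
      · obtain ⟨p, hp⟩ := L.exists_diff_ne_zero (X := X) (v := b i) (w := b j)
          (fun e => hij.1 ⟨h1.symm, e⟩)
        have h2 : b j ≠ a i := fun e => hj' (h1.trans e.symm)
        exact ⟨p, by simpa [θ, diff, h1, h2] using hp⟩
      · by_cases h2 : b j = a i
        · obtain ⟨p, hp⟩ := L.exists_diff_ne_zero (X := X) (v := a j) (w := b i)
            (fun e => hij.2 ⟨h2.symm, e.symm⟩)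
          exact ⟨p, by simpa [θ, diff, h1, h2] using hp⟩
        · obtain ⟨p, hp⟩ := L.exists_diff_ne_zero (X := X) hj'
          exact ⟨p, by simpa [θ, diff, h1, h2] using hp⟩
    obtain ⟨q, hq⟩ := hprod
    have hz := L.eq_zero_of_mul (L.comp_mem hθm hg)
      (L.prod_mem s fun j _ => L.comp_mem hθm (L.diff_mem (a j) (b j))) hq fun p hp => by
        have h0 := h i (by simp) (θ p) (by simp [θ, hi'.symm])
        rw [hfg] at h0
        exact (mul_eq_zero.1 h0).resolve_left hp
    obtain ⟨g', hg', hgg'⟩ := L.exists_eq_diff_mul hg (a i) (b i) fun p hp => by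
      have := hz p
      rwa [show θ p = p by simp [θ, ← hp]] at this
    exact ⟨g', hg', fun p => by rw [Finset.prod_insert hi, hfg, hgg']; ring⟩

end LineModel

/-! ### Vandermonde products and the weight. -/

section Vandermonde

variable {k : Type*} [Field k] {m n : ℕ}

/-- The Vandermonde product `∏_{i < j} (x_j - x_i)`. -/
def vand (x : Fin m → k) : k := ∏ i, ∏ j, if i < j then x j - x i else 1

/-- The part of the Vandermonde product that comes from the pairs of indices in the same block, the
blocks being the indices below `s` and the other ones. -/
def blockVand (s : ℕ) (x : Fin m → k) : k :=
  ∏ i : Fin m, ∏ j : Fin m, if i < j ∧ ((i : ℕ) < s ↔ (j : ℕ) < s) then x j - x i else 1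

/-- The product of the `z - x_i` with `i < s`. -/
def low (s : ℕ) (z : k) (x : Fin m → k) : k := ∏ i : Fin m, if (i : ℕ) < s then z - x i else 1

/-- The product of the `x_a - y_b` with `s ≤ a` and `s ≤ b`. -/
def highRes (s : ℕ) (x : Fin m → k) (y : Fin n → k) : k :=
  ∏ a : Fin m, ∏ b : Fin n, if s ≤ a ∧ s ≤ b then x a - y b else 1

/-- The weight whose sum over `S_m × S_n` extends functions from a stratum. -/
def weight (s : ℕ) (x : Fin m → k) (y : Fin n → k) : k :=
  highRes s x y * (∏ b : Fin n, if s ≤ b then low s (y b) x / low s (y b) y else 1) *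
    (∏ a : Fin m, if s ≤ a then low s (x a) y / low s (x a) x else 1)

/-- The weight multiplied by the Vandermonde products. -/
def weightNum (s : ℕ) (x : Fin m → k) (y : Fin n → k) : k :=
  highRes s x y * (∏ b : Fin n, if s ≤ b then low s (y b) x else 1) *
    (∏ a : Fin m, if s ≤ a then low s (x a) y else 1) * blockVand s x * blockVand s y

theorem vand_eq_det (x : Fin m → k) : vand x = (Matrix.vandermonde x).det := by
  rw [Matrix.det_vandermonde, vand]
  refine Finset.prod_congr rfl fun i _ => ?_
  rw [← Finset.prod_filter]
  congr 1
  ext j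
  simp

theorem vand_comp_perm (x : Fin m → k) (σ : Equiv.Perm (Fin m)) :
    vand (x ∘ σ) = (Equiv.Perm.sign σ : ℤ) * vand x := by
  rw [vand_eq_det, vand_eq_det, ← Matrix.det_permute]
  rfl

theorem vand_ne_zero_iff (x : Fin m → k) : vand x ≠ 0 ↔ Injective x := by
  rw [vand_eq_det, Matrix.det_vandermonde_ne_zero_iff]

/-- The pairs that meet both blocks are those with `i < s ≤ j`. Grouped by the larger index they
form the denominators of `weight`, which therefore divide the Vandermonde products. -/
theorem vand_eq_blockVand_mul (s : ℕ) (x : Fin m → k) :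
    vand x = blockVand s x * ∏ a : Fin m, if s ≤ a then low s (x a) x else 1 := by
  have : (∏ a : Fin m, if s ≤ a then low s (x a) x else 1) =
      ∏ i : Fin m, ∏ j : Fin m, if (i : ℕ) < s ∧ s ≤ j then x j - x i else 1 := by
    rw [Finset.prod_comm]
    refine Finset.prod_congr rfl fun a _ => ?_
    by_cases h : s ≤ a <;> simp [h, low]
  rw [this, vand, blockVand, ← Finset.prod_mul_distrib]
  refine Finset.prod_congr rfl fun i _ => ?_
  rw [← Finset.prod_mul_distrib]
  refine Finset.prod_congr rfl fun j _ => ?_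
  simp only [Fin.lt_def]
  split_ifs <;> first | omega | simp

theorem low_ne_zero {s : ℕ} {z : k} {x : Fin m → k} (h : ∀ i : Fin m, (i : ℕ) < s → z ≠ x i) :
    low s z x ≠ 0 := by
  refine Finset.prod_ne_zero_iff.2 fun i _ => ?_
  split_ifs with hi
  exacts [sub_ne_zero.2 (h i hi), one_ne_zero]

theorem low_self_ne_zero {s : ℕ} {x : Fin m → k} (hx : Injective x) {a : Fin m} (ha : s ≤ a) :
    low s (x a) x ≠ 0 :=
  low_ne_zero fun i hi e => by
    have := hx e
    subst this
    omega

theorem low_eq_zero {s : ℕ} {z : k} {x : Fin m → k} {i : Fin m} (hi : (i : ℕ) < s) (h : z = x i) :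
    low s z x = 0 :=
  Finset.prod_eq_zero (Finset.mem_univ i) (by simp [hi, h])

theorem weightNum_eq (s : ℕ) {x : Fin m → k} {y : Fin n → k} (hx : Injective x)
    (hy : Injective y) : weightNum s x y = vand x * vand y * weight s x y := by
  have key : ∀ {l : ℕ} (z : Fin l → k) (hz : Injective z) (u : Fin l → k),
      (∏ b : Fin l, if s ≤ b then u b else 1) =
        (∏ b : Fin l, if s ≤ b then low s (z b) z else 1) *
          ∏ b : Fin l, if s ≤ b then u b / low s (z b) z else 1 := by
    intro l z hz u
    rw [← Finset.prod_mul_distrib]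
    refine Finset.prod_congr rfl fun b _ => ?_
    split_ifs with h
    · rw [mul_div_cancel₀ _ (low_self_ne_zero hz h)]
    · simp
  rw [weightNum, weight, vand_eq_blockVand_mul s x, vand_eq_blockVand_mul s y,
    key y hy fun b => low s (y b) x, key x hx fun a => low s (x a) y]
  ring

/-- Each position of the pair is handled by one factor: `highRes` if both indices are high, and one
of the two mixed products if exactly one is. -/
theorem weight_eq_zero {s : ℕ} {x : Fin m → k} {y : Fin n → k} {i : Fin m} {j : Fin n}
    (h : x i = y j) (hij : ¬((i : ℕ) < s ∧ (j : ℕ) < s)) : weight s x y = 0 := by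
  by_cases hi : s ≤ i
  · by_cases hj : s ≤ j
    · have : highRes s x y = 0 := Finset.prod_eq_zero (Finset.mem_univ i)
        (Finset.prod_eq_zero (Finset.mem_univ j) (by simp [hi, hj, h]))
      simp [weight, this]
    · have : (∏ a : Fin m, if s ≤ a then low s (x a) y / low s (x a) x else 1) = 0 :=
        Finset.prod_eq_zero (Finset.mem_univ i)
          (by simp [hi, low_eq_zero (not_le.1 hj) h])
      simp [weight, this]
  · have hj : s ≤ j := by omega
    have : (∏ b : Fin n, if s ≤ b then low s (y b) x / low s (y b) y else 1) = 0 :=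
      Finset.prod_eq_zero (Finset.mem_univ j)
        (by simp [hj, low_eq_zero (not_le.1 hi) h.symm])
    simp [weight, this]

theorem low_eq_mul {s : ℕ} (z : k) {x x' : Fin m → k} {i : Fin m} (hi : (i : ℕ) < s)
    (h : ∀ a, a ≠ i → x a = x' a) : ∃ r, low s z x = (z - x i) * r ∧ low s z x' = (z - x' i) * r := by
  refine ⟨∏ a ∈ Finset.univ.erase i, if (a : ℕ) < s then z - x a else 1, ?_, ?_⟩
  · rw [low, ← Finset.mul_prod_erase _ _ (Finset.mem_univ i), if_pos hi]
  · rw [low, ← Finset.mul_prod_erase _ _ (Finset.mem_univ i), if_pos hi]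
    congr 1
    refine Finset.prod_congr rfl fun a ha => ?_
    rw [h a (Finset.ne_of_mem_erase ha)]

/-- In `low s z x / low s z y` the factors `z - x i` and `z - y j` cancel. The identity is stated
cross-multiplied to avoid zero denominators. -/
theorem low_mul_low_eq {s : ℕ} (z : k) {x x' : Fin m → k} {y y' : Fin n → k} {i : Fin m} {j : Fin n}
    (hi : (i : ℕ) < s) (hj : (j : ℕ) < s) (hx : ∀ a, a ≠ i → x a = x' a)
    (hy : ∀ b, b ≠ j → y b = y' b) (h : x i = y j) (h' : x' i = y' j) :
    low s z x * low s z y' = low s z x' * low s z y := by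
  obtain ⟨r, h1, h2⟩ := low_eq_mul z hi hx
  obtain ⟨r', h3, h4⟩ := low_eq_mul z hj hy
  rw [h1, h2, h3, h4, h, h']
  ring

/-- The weight depends on two equal variables `x_i = y_j` only through the other variables. -/
theorem weight_congr {s : ℕ} {x x' : Fin m → k} {y y' : Fin n → k} {i : Fin m} {j : Fin n}
    (hx : ∀ a, a ≠ i → x a = x' a) (hy : ∀ b, b ≠ j → y b = y' b) (h : x i = y j)
    (h' : x' i = y' j) (ix : Injective x) (ix' : Injective x') (iy : Injective y)
    (iy' : Injective y') : weight s x y = weight s x' y' := by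
  by_cases hij : (i : ℕ) < s ∧ (j : ℕ) < s
  · obtain ⟨hi, hj⟩ := hij
    have hx' : ∀ a : Fin m, s ≤ a → x a = x' a := fun a ha => hx a (by rintro rfl; omega)
    have hy' : ∀ b : Fin n, s ≤ b → y b = y' b := fun b hb => hy b (by rintro rfl; omega)
    unfold weight highRes
    congr 1
    · congr 1
      · refine Finset.prod_congr rfl fun a _ => Finset.prod_congr rfl fun b _ => ?_
        split_ifs with hab
        · rw [hx' a hab.1, hy' b hab.2]
        · rfl
      · refine Finset.prod_congr rfl fun b _ => ?_
        split_ifs with hb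
        · rw [div_eq_div_iff (low_self_ne_zero iy hb) (low_self_ne_zero iy' hb), hy' b hb]
          exact low_mul_low_eq _ hi hj hx hy h h'
        · rfl
    · refine Finset.prod_congr rfl fun a _ => ?_
      split_ifs with ha
      · rw [div_eq_div_iff (low_self_ne_zero ix ha) (low_self_ne_zero ix' ha), hx' a ha]
        exact low_mul_low_eq _ hj hi hy hx h.symm h'.symm
      · rfl
  · rw [weight_eq_zero h hij, weight_eq_zero h' hij]

theorem low_comp_perm {s : ℕ} (z : k) (x : Fin m → k) {σ : Equiv.Perm (Fin m)}
    (hσ : ∀ a, (σ a : ℕ) < s ↔ (a : ℕ) < s) : low s z (x ∘ σ) = low s z x := by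
  refine Fintype.prod_equiv σ _ _ fun a => ?_
  simp [hσ]

theorem highRes_comp_perm {s : ℕ} (x : Fin m → k) (y : Fin n → k) {σ : Equiv.Perm (Fin m)}
    {τ : Equiv.Perm (Fin n)} (hσ : ∀ a, (σ a : ℕ) < s ↔ (a : ℕ) < s)
    (hτ : ∀ a, (τ a : ℕ) < s ↔ (a : ℕ) < s) : highRes s (x ∘ σ) (y ∘ τ) = highRes s x y := by
  have hσ' : ∀ a, s ≤ (σ a : ℕ) ↔ s ≤ (a : ℕ) := fun a => by simpa using not_congr (hσ a)
  have hτ' : ∀ a, s ≤ (τ a : ℕ) ↔ s ≤ (a : ℕ) := fun a => by simpa using not_congr (hτ a)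
  refine Fintype.prod_equiv σ _ _ fun a => Fintype.prod_equiv τ _ _ fun b => ?_
  simp [hσ', hτ']

theorem weight_comp_perm {s : ℕ} (x : Fin m → k) (y : Fin n → k) {σ : Equiv.Perm (Fin m)}
    {τ : Equiv.Perm (Fin n)} (hσ : ∀ a, (σ a : ℕ) < s ↔ (a : ℕ) < s)
    (hτ : ∀ a, (τ a : ℕ) < s ↔ (a : ℕ) < s) : weight s (x ∘ σ) (y ∘ τ) = weight s x y := by
  have hσ' : ∀ a, s ≤ (σ a : ℕ) ↔ s ≤ (a : ℕ) := fun a => by simpa using not_congr (hσ a)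
  have hτ' : ∀ a, s ≤ (τ a : ℕ) ↔ s ≤ (a : ℕ) := fun a => by simpa using not_congr (hτ a)
  simp only [weight, highRes_comp_perm x y hσ hτ, low_comp_perm _ x hσ, low_comp_perm _ y hτ]
  congr 1
  · congr 1
    refine Fintype.prod_equiv τ _ _ fun b => ?_
    simp [hτ']
  · refine Fintype.prod_equiv σ _ _ fun a => ?_
    simp [hσ']

theorem low_eq_low {s : ℕ} (hm : s ≤ m) (hn : s ≤ n) (z : k) {x : Fin m → k} {y : Fin n → k}
    (h : ∀ (i : Fin m) (j : Fin n), (i : ℕ) = j → (i : ℕ) < s → x i = y j) :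
    low s z x = low s z y := by
  have key : ∀ {l : ℕ} (hl : s ≤ l) (u : Fin l → k),
      low s z u = ∏ i : Fin s, (z - u (Fin.castLE hl i)) := by
    intro l hl u
    rw [low, ← Finset.prod_filter]
    symm
    refine Finset.prod_bij (fun i _ => Fin.castLE hl i) (by simp)
      (fun a _ b _ hab => Fin.castLE_injective hl hab) (fun b hb => ?_) (fun _ _ => rfl)
    exact ⟨⟨b, by simpa using hb⟩, by simp, rfl⟩
  rw [key hm, key hn]
  refine Finset.prod_congr rfl fun i _ => ?_
  rw [h (Fin.castLE hm i) (Fin.castLE hn i) rfl (by simp)]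

/-- On the stratum the low variables of both kinds coincide, so all quotients in the weight are `1`.
-/
theorem weight_eq_highRes {s : ℕ} (hm : s ≤ m) (hn : s ≤ n) {x : Fin m → k} {y : Fin n → k}
    (hx : Injective x) (hy : Injective y)
    (h : ∀ (i : Fin m) (j : Fin n), (i : ℕ) = j → (i : ℕ) < s → x i = y j) :
    weight s x y = highRes s x y := by
  have h1 : (∏ b : Fin n, if s ≤ b then low s (y b) x / low s (y b) y else 1) = 1 := by
    refine Finset.prod_eq_one fun b _ => ?_
    split_ifs with hb
    · rw [low_eq_low hm hn _ h, div_self (low_self_ne_zero hy hb)]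
    · rfl
  have h2 : (∏ b : Fin m, if s ≤ b then low s (x b) y / low s (x b) x else 1) = 1 := by
    refine Finset.prod_eq_one fun b _ => ?_
    split_ifs with hb
    · rw [← low_eq_low hm hn _ h, div_self (low_self_ne_zero hx hb)]
    · rfl
  rw [weight, h1, h2, mul_one, mul_one]

end Vandermonde

/-! ### Strata and permutations of coordinates. -/

/-- The point in which the coordinates with index below `s` are replaced by `x₀`. -/
def collapse {X : Type*} {m n : ℕ} (s : ℕ) (x₀ : X) (p : Fin m ⊕ Fin n → X) :
    Fin m ⊕ Fin n → X :=
  fun v => if Sum.elim (fun i : Fin m => (i : ℕ)) (fun j : Fin n => (j : ℕ)) v < s then x₀ else p v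

/-- A permutation of `Fin m` preserves the set of indices below `s`. -/
def PreservesLow {m : ℕ} (s : ℕ) (σ : Equiv.Perm (Fin m)) : Prop :=
  ∀ a, (σ a : ℕ) < s ↔ (a : ℕ) < s

theorem comp_perm_mul {X : Type*} {m n : ℕ} (p : Fin m ⊕ Fin n → X) (σ σ' : Equiv.Perm (Fin m))
    (τ τ' : Equiv.Perm (Fin n)) : p ∘ perm (σ * σ') (τ * τ') = (p ∘ perm σ τ) ∘ perm σ' τ' := by
  ext v
  cases v <;> rfl

theorem comp_perm_one {X : Type*} {m n : ℕ} (p : Fin m ⊕ Fin n → X) :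
    p ∘ perm 1 1 = p := by
  ext v
  cases v <;> rfl

theorem collapse_comp_perm {X : Type*} {m n s : ℕ} (x₀ : X) (p : Fin m ⊕ Fin n → X)
    {σ : Equiv.Perm (Fin m)} {τ : Equiv.Perm (Fin n)} (hσ : PreservesLow s σ)
    (hτ : PreservesLow s τ) : collapse s x₀ (p ∘ perm σ τ) = collapse s x₀ p ∘ perm σ τ := by
  ext v
  rcases v with a | b
  · have := hσ a
    simp only [collapse, perm, comp_apply, Sum.map_inl, Sum.elim_inl]
    exact if_congr this.symm rfl rfl
  · have := hτ b
    simp only [collapse, perm, comp_apply, Sum.map_inr, Sum.elim_inr]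
    exact if_congr this.symm rfl rfl

theorem isCoordMap_collapse {X : Type*} {m n : ℕ} (s : ℕ) (x₀ : X) :
    IsCoordMap (collapse (m := m) (n := n) s x₀) := by
  intro v
  by_cases h : Sum.elim (fun i : Fin m => (i : ℕ)) (fun j : Fin n => (j : ℕ)) v < s
  · exact Or.inr ⟨x₀, fun p => by simp [collapse, h]⟩
  · exact Or.inl ⟨v, fun p => by simp [collapse, h]⟩

theorem collapse_collapse {X : Type*} {m n : ℕ} (s : ℕ) (x₀ : X) (p : Fin m ⊕ Fin n → X) :
    collapse s x₀ (collapse s x₀ p) = collapse s x₀ p := by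
  ext v
  simp only [collapse]
  split_ifs <;> rfl

theorem collapse_zero {X : Type*} {m n : ℕ} (x₀ : X) (p : Fin m ⊕ Fin n → X) :
    collapse 0 x₀ p = p := by
  ext v
  simp [collapse]

/-! ### Supersymmetric functions and alternating sums. -/

namespace LineModel

variable {k X : Type*} [Field k] (L : LineModel k X) {m n : ℕ}

/-- The coordinates of the first kind of a point. -/
def xs (p : Fin m ⊕ Fin n → X) : Fin m → k := fun i => L.coord (p (Sum.inl i))

/-- The coordinates of the second kind of a point. -/
def ys (p : Fin m ⊕ Fin n → X) : Fin n → k := fun i => L.coord (p (Sum.inr i))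

/-- The algebra of supersymmetric regular functions. -/
def superFun (m n : ℕ) : Subalgebra k ((Fin m ⊕ Fin n → X) → k) where
  carrier := {f | f ∈ regular L.gens (Fin m ⊕ Fin n) ∧
    (∀ (σ : Equiv.Perm (Fin m)) (τ : Equiv.Perm (Fin n)) p, f (p ∘ perm σ τ) = f p) ∧
    ∀ (i : Fin m) (j : Fin n) p q, p (Sum.inl i) = p (Sum.inr j) → q (Sum.inl i) = q (Sum.inr j) →
      (∀ v, v ≠ Sum.inl i → v ≠ Sum.inr j → p v = q v) → f p = f q}
  mul_mem' := by
    rintro f g ⟨hf, hf', hf''⟩ ⟨hg, hg', hg''⟩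
    refine ⟨mul_mem hf hg, fun σ τ p => ?_, fun i j p q hp hq h => ?_⟩
    · simp only [Pi.mul_apply, hf', hg']
    · simp only [Pi.mul_apply, hf'' i j p q hp hq h, hg'' i j p q hp hq h]
  add_mem' := by
    rintro f g ⟨hf, hf', hf''⟩ ⟨hg, hg', hg''⟩
    refine ⟨add_mem hf hg, fun σ τ p => ?_, fun i j p q hp hq h => ?_⟩
    · simp only [Pi.add_apply, hf', hg']
    · simp only [Pi.add_apply, hf'' i j p q hp hq h, hg'' i j p q hp hq h]
  algebraMap_mem' r := ⟨Subalgebra.algebraMap_mem _ r, fun _ _ _ => rfl, fun _ _ _ _ _ _ _ => rfl⟩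

theorem vand_xs_mem :
    (fun p : Fin m ⊕ Fin n → X => vand (L.xs p)) ∈ regular L.gens (Fin m ⊕ Fin n) :=
  L.prod_mem _ fun i _ => L.prod_mem _ fun j _ =>
    L.ite_mem (L.diff_mem (Sum.inl j) (Sum.inl i)) (L.const_mem 1)

theorem vand_ys_mem :
    (fun p : Fin m ⊕ Fin n → X => vand (L.ys p)) ∈ regular L.gens (Fin m ⊕ Fin n) :=
  L.prod_mem _ fun i _ => L.prod_mem _ fun j _ =>
    L.ite_mem (L.diff_mem (Sum.inr j) (Sum.inr i)) (L.const_mem 1)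

theorem vand_mul_vand_mem :
    (fun p : Fin m ⊕ Fin n → X => vand (L.xs p) * vand (L.ys p)) ∈
      regular L.gens (Fin m ⊕ Fin n) :=
  mul_mem L.vand_xs_mem L.vand_ys_mem

theorem highRes_mem (s : ℕ) :
    (fun p : Fin m ⊕ Fin n → X => highRes s (L.xs p) (L.ys p)) ∈ regular L.gens (Fin m ⊕ Fin n) :=
  L.prod_mem _ fun i _ => L.prod_mem _ fun j _ =>
    L.ite_mem (L.diff_mem (Sum.inl i) (Sum.inr j)) (L.const_mem 1)

theorem weightNum_mem (s : ℕ) :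
    (fun p : Fin m ⊕ Fin n → X => weightNum s (L.xs p) (L.ys p)) ∈
      regular L.gens (Fin m ⊕ Fin n) := by
  refine mul_mem (mul_mem (mul_mem (mul_mem (L.highRes_mem s) ?_) ?_) ?_) ?_
  · exact L.prod_mem _ fun b _ => L.ite_mem (L.prod_mem _ fun i _ =>
      L.ite_mem (L.diff_mem (Sum.inr b) (Sum.inl i)) (L.const_mem 1)) (L.const_mem 1)
  · exact L.prod_mem _ fun b _ => L.ite_mem (L.prod_mem _ fun i _ =>
      L.ite_mem (L.diff_mem (Sum.inl b) (Sum.inr i)) (L.const_mem 1)) (L.const_mem 1)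
  · exact L.prod_mem _ fun i _ => L.prod_mem _ fun j _ =>
      L.ite_mem (L.diff_mem (Sum.inl j) (Sum.inl i)) (L.const_mem 1)
  · exact L.prod_mem _ fun i _ => L.prod_mem _ fun j _ =>
      L.ite_mem (L.diff_mem (Sum.inr j) (Sum.inr i)) (L.const_mem 1)

/-- A regular function that is alternating in both sets of variables is divisible by the product of
the two Vandermonde products. -/
theorem exists_eq_vand_mul [Infinite X] [CharZero k] {F : (Fin m ⊕ Fin n → X) → k}
    (hF : F ∈ regular L.gens (Fin m ⊕ Fin n))
    (h : ∀ (σ : Equiv.Perm (Fin m)) (τ : Equiv.Perm (Fin n)) p,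
      F (p ∘ perm σ τ) = (Equiv.Perm.sign σ : ℤ) * (Equiv.Perm.sign τ : ℤ) * F p) :
    ∃ f ∈ regular L.gens (Fin m ⊕ Fin n), ∀ p, F p = vand (L.xs p) * vand (L.ys p) * f p := by
  let E : Finset ((Fin m × Fin m) ⊕ (Fin n × Fin n)) :=
    (Finset.univ.filter fun e => e.1 < e.2).disjSum (Finset.univ.filter fun e => e.1 < e.2)
  let a : (Fin m × Fin m) ⊕ (Fin n × Fin n) → Fin m ⊕ Fin n := Sum.map Prod.snd Prod.snd
  let b : (Fin m × Fin m) ⊕ (Fin n × Fin n) → Fin m ⊕ Fin n := Sum.map Prod.fst Prod.fst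
  suffices H : ∃ f ∈ regular L.gens (Fin m ⊕ Fin n), ∀ p,
      F p = (∏ e ∈ E, L.diff p (a e) (b e)) * f p by
    obtain ⟨f, hf, hFf⟩ := H
    refine ⟨f, hf, fun p => ?_⟩
    rw [hFf, Finset.prod_disjSum]
    simp only [Finset.prod_filter, Fintype.prod_prod_type]
    rfl
  refine L.exists_eq_prod_diff_mul E a b ?_ ?_ hF ?_
  · rintro (⟨i, j⟩ | ⟨i, j⟩) he
    · simpa [E, a, b] using (show i < j by simpa [E] using he).ne'
    · simpa [E, a, b] using (show i < j by simpa [E] using he).ne'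
  · rintro (⟨i, j⟩ | ⟨i, j⟩) he (⟨i', j'⟩ | ⟨i', j'⟩) he' hne
    · have h1 : i < j := by simpa [E] using he
      have h2 : i' < j' := by simpa [E] using he'
      simp only [a, b, Sum.map_inl, Sum.inl.injEq, ne_eq, Prod.mk.injEq] at hne ⊢
      omega
    · simp [a, b]
    · simp [a, b]
    · have h1 : i < j := by simpa [E] using he
      have h2 : i' < j' := by simpa [E] using he'
      simp only [a, b, Sum.map_inr, Sum.inr.injEq, ne_eq, Prod.mk.injEq] at hne ⊢
      omega
  · rintro (⟨i, j⟩ | ⟨i, j⟩) he p hp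
    · have h1 : i < j := by simpa [E] using he
      -- The transposition fixes every point of its diagonal, so `F p = -F p`, and `F p = 0` in
      -- characteristic zero.
      have h2 : p ∘ perm (Equiv.swap i j) 1 = p := by
        ext v
        rcases v with v | v
        · simp only [a, b, Sum.map_inl] at hp
          simp only [comp_apply, perm, Sum.map_inl, Equiv.swap_apply_def]
          split_ifs with e1 e2
          · rw [e1, hp]
          · rw [e2, hp]
          · rfl
        · rfl
      have h3 := h (Equiv.swap i j) 1 p
      rw [h2, Equiv.Perm.sign_swap h1.ne] at h3
      simp only [Units.val_neg, Units.val_one, Int.cast_neg, Int.cast_one, map_one] at h3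
      exact self_eq_neg.1 (by linear_combination h3)
    · have h1 : i < j := by simpa [E] using he
      have h2 : p ∘ perm 1 (Equiv.swap i j) = p := by
        ext v
        rcases v with v | v
        · rfl
        · simp only [a, b, Sum.map_inr] at hp
          simp only [comp_apply, perm, Sum.map_inr, Equiv.swap_apply_def]
          split_ifs with e1 e2
          · rw [e1, hp]
          · rw [e2, hp]
          · rfl
      have h3 := h 1 (Equiv.swap i j) p
      rw [h2, Equiv.Perm.sign_swap h1.ne] at h3
      simp only [Units.val_neg, Units.val_one, Int.cast_neg, Int.cast_one, map_one] at h3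
      exact self_eq_neg.1 (by linear_combination h3)

/-- The alternating sum over `S_m × S_n` of the numerators of the weights, times a function. -/
def altSum (s : ℕ) (g : (Fin m ⊕ Fin n → X) → k) (p : Fin m ⊕ Fin n → X) : k :=
  ∑ στ : Equiv.Perm (Fin m) × Equiv.Perm (Fin n),
    ((Equiv.Perm.sign στ.1 : ℤ) * (Equiv.Perm.sign στ.2 : ℤ) : k) *
      (weightNum s (L.xs (p ∘ perm στ.1 στ.2)) (L.ys (p ∘ perm στ.1 στ.2)) *
        g (p ∘ perm στ.1 στ.2))

theorem altSum_mem (s : ℕ) {g : (Fin m ⊕ Fin n → X) → k}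
    (hg : g ∈ regular L.gens (Fin m ⊕ Fin n)) :
    L.altSum s g ∈ regular L.gens (Fin m ⊕ Fin n) :=
  L.sum_mem _ fun στ _ => mul_mem (L.const_mem _)
    (L.comp_mem (θ := fun p => p ∘ perm στ.1 στ.2) (isCoordMap_reindex _)
      (mul_mem (L.weightNum_mem s) hg))

theorem sign_mul_self_cast (σ : Equiv.Perm (Fin m)) :
    ((Equiv.Perm.sign σ : ℤ) : k) * ((Equiv.Perm.sign σ : ℤ) : k) = 1 := by
  rw [← Int.cast_mul, ← Units.val_mul, Int.units_mul_self]
  simp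

theorem altSum_comp_perm (s : ℕ) (g : (Fin m ⊕ Fin n → X) → k) (σ : Equiv.Perm (Fin m))
    (τ : Equiv.Perm (Fin n)) (p : Fin m ⊕ Fin n → X) :
    L.altSum s g (p ∘ perm σ τ) =
      (Equiv.Perm.sign σ : ℤ) * (Equiv.Perm.sign τ : ℤ) * L.altSum s g p := by
  rw [altSum, altSum, Finset.mul_sum]
  refine Fintype.sum_equiv (Equiv.mulLeft ((σ, τ) : Equiv.Perm (Fin m) × Equiv.Perm (Fin n)))
    _ _ fun στ => ?_
  simp only [Equiv.coe_mulLeft, Prod.fst_mul, Prod.snd_mul, comp_perm_mul, map_mul,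
    Units.val_mul, Int.cast_mul]
  have h1 := sign_mul_self_cast (k := k) σ
  have h2 := sign_mul_self_cast (k := k) τ
  set A := weightNum s (L.xs ((p ∘ perm σ τ) ∘ perm στ.1 στ.2))
    (L.ys ((p ∘ perm σ τ) ∘ perm στ.1 στ.2)) * g ((p ∘ perm σ τ) ∘ perm στ.1 στ.2)
  linear_combination (-((Equiv.Perm.sign στ.1 : ℤ) : k) * ((Equiv.Perm.sign στ.2 : ℤ) : k) * A) *
    (h1 * ((Equiv.Perm.sign τ : ℤ) : k) * ((Equiv.Perm.sign τ : ℤ) : k) + h2)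

/-- All coordinates of the same kind are distinct. -/
def Generic (p : Fin m ⊕ Fin n → X) : Prop := vand (L.xs p) * vand (L.ys p) ≠ 0

variable {L}

theorem Generic.xs {p : Fin m ⊕ Fin n → X} (hp : L.Generic p) : Injective (L.xs p) :=
  (vand_ne_zero_iff _).1 (left_ne_zero_of_mul hp)

theorem Generic.ys {p : Fin m ⊕ Fin n → X} (hp : L.Generic p) : Injective (L.ys p) :=
  (vand_ne_zero_iff _).1 (right_ne_zero_of_mul hp)

variable (L) in
theorem generic_of_injective {p : Fin m ⊕ Fin n → X} (h1 : Injective (p ∘ Sum.inl))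
    (h2 : Injective (p ∘ Sum.inr)) : L.Generic p :=
  mul_ne_zero ((vand_ne_zero_iff _).2 (L.coord_injective.comp h1))
    ((vand_ne_zero_iff _).2 (L.coord_injective.comp h2))

theorem Generic.comp_perm {p : Fin m ⊕ Fin n → X} (hp : L.Generic p) (σ : Equiv.Perm (Fin m))
    (τ : Equiv.Perm (Fin n)) : L.Generic (p ∘ perm σ τ) :=
  mul_ne_zero ((vand_ne_zero_iff _).2 (hp.xs.comp σ.injective))
    ((vand_ne_zero_iff _).2 (hp.ys.comp τ.injective))

variable (L)

theorem altSum_eq {s : ℕ} {g : (Fin m ⊕ Fin n → X) → k} {p : Fin m ⊕ Fin n → X}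
    (hp : L.Generic p) : L.altSum s g p = vand (L.xs p) * vand (L.ys p) *
      ∑ στ : Equiv.Perm (Fin m) × Equiv.Perm (Fin n),
        weight s (L.xs p ∘ στ.1) (L.ys p ∘ στ.2) * g (p ∘ perm στ.1 στ.2) := by
  rw [altSum, Finset.mul_sum]
  refine Finset.sum_congr rfl fun στ _ => ?_
  have h := hp.comp_perm στ.1 στ.2
  rw [weightNum_eq s h.xs h.ys]
  change _ * (vand (L.xs p ∘ στ.1) * vand (L.ys p ∘ στ.2) *
    weight s (L.xs p ∘ στ.1) (L.ys p ∘ στ.2) * _) = _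
  rw [vand_comp_perm, vand_comp_perm]
  have h1 := sign_mul_self_cast (k := k) στ.1
  have h2 := sign_mul_self_cast (k := k) στ.2
  set A := weight s (L.xs p ∘ στ.1) (L.ys p ∘ στ.2) * g (p ∘ perm στ.1 στ.2)
  linear_combination (vand (L.xs p) * vand (L.ys p) * A) *
    (h1 * ((Equiv.Perm.sign στ.2 : ℤ) : k) * ((Equiv.Perm.sign στ.2 : ℤ) : k) + h2)

theorem exists_injective_avoiding [Infinite X] (t u : X) :
    ∃ p : Fin m ⊕ Fin n → X, Injective p ∧ ∀ v, p v ≠ t ∧ p v ≠ u := by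
  have : Infinite ↥(({t, u} : Set X)ᶜ) := (Set.toFinite _).infinite_compl.to_subtype
  let e : Fin m ⊕ Fin n ↪ ↥(({t, u} : Set X)ᶜ) := (Fintype.equivFin _).toEmbedding.trans
    (Fin.valEmbedding.trans (Infinite.natEmbedding _))
  refine ⟨fun v => e v, Subtype.val_injective.comp e.injective, fun v => ?_⟩
  have h := (e v).2
  rw [Set.mem_compl_iff, Set.mem_insert_iff, Set.mem_singleton_iff, not_or] at h
  exact h

/-- The point whose coordinates with the indices `xᵢ` and `yⱼ` are replaced by `t`. -/
def setPair {X : Type*} (i : Fin m) (j : Fin n) (t : X) (p : Fin m ⊕ Fin n → X) :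
    Fin m ⊕ Fin n → X :=
  update (update p (Sum.inl i) t) (Sum.inr j) t

theorem isCoordMap_setPair {X : Type*} (i : Fin m) (j : Fin n) (t : X) :
    IsCoordMap (setPair i j t) := by
  rintro (a | b)
  · by_cases h : a = i
    · exact Or.inr ⟨t, fun p => by simp [setPair, h]⟩
    · exact Or.inl ⟨Sum.inl a, fun p => by simp [setPair, h]⟩
  · by_cases h : b = j
    · exact Or.inr ⟨t, fun p => by simp [setPair, h]⟩
    · exact Or.inl ⟨Sum.inr b, fun p => by simp [setPair, h]⟩

/-- Genericity only compares coordinates of the same kind, so the coincidence of one `x` with one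
`y` does no harm. -/
theorem generic_setPair {i : Fin m} {j : Fin n} {t : X} {p : Fin m ⊕ Fin n → X}
    (hp : Injective p) (ht : ∀ v, p v ≠ t) : L.Generic (setPair i j t p) := by
  apply L.generic_of_injective
  · have : setPair i j t p ∘ Sum.inl = update (p ∘ Sum.inl) i t := by
      ext a
      by_cases h : a = i <;> simp [setPair, h]
    rw [this]
    intro a b hab
    by_cases ha : a = i <;> by_cases hb : b = i
    · rw [ha, hb]
    · exact absurd (by simpa [ha, hb] using hab.symm) (ht (Sum.inl b))
    · exact absurd (by simpa [ha, hb] using hab) (ht (Sum.inl a))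
    · exact Sum.inl_injective (hp (by simpa [ha, hb] using hab))
  · have : setPair i j t p ∘ Sum.inr = update (p ∘ Sum.inr) j t := by
      ext a
      by_cases h : a = j <;> simp [setPair, h]
    rw [this]
    intro a b hab
    by_cases ha : a = j <;> by_cases hb : b = j
    · rw [ha, hb]
    · exact absurd (by simpa [ha, hb] using hab.symm) (ht (Sum.inr b))
    · exact absurd (by simpa [ha, hb] using hab) (ht (Sum.inr a))
    · exact Sum.inr_injective (hp (by simpa [ha, hb] using hab))

theorem setPair_eq {X : Type*} {i : Fin m} {j : Fin n} {p q : Fin m ⊕ Fin n → X}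
    (hq : q (Sum.inl i) = q (Sum.inr j))
    (h : ∀ v, v ≠ Sum.inl i → v ≠ Sum.inr j → p v = q v) :
    setPair i j (q (Sum.inl i)) p = q := by
  ext v
  rcases v with a | b
  · by_cases ha : a = i
    · simp [setPair, ha]
    · simpa [setPair, ha] using h (Sum.inl a) (by simpa using ha) (by simp)
  · by_cases hb : b = j
    · simp [setPair, hb, hq]
    · simpa [setPair, hb] using h (Sum.inr b) (by simp) (by simpa using hb)

end LineModel

/-! ### Extension of functions from a stratum. -/

namespace LineModel

variable {k X : Type*} [Field k] (L : LineModel k X) {m n : ℕ}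

theorem exists_generic [Infinite X] : ∃ p : Fin m ⊕ Fin n → X, L.Generic p := by
  obtain ⟨t⟩ : Nonempty X := inferInstance
  obtain ⟨r, hr, -⟩ := exists_injective_avoiding (m := m) (n := n) t t
  exact ⟨r, L.generic_of_injective (hr.comp Sum.inl_injective) (hr.comp Sum.inr_injective)⟩

/-- Supersymmetry holds in each summand separately. If both indices are low, neither `g` nor the
weight sees the common value; otherwise both weights vanish. -/
theorem weight_mul_congr {s : ℕ} {x₀ : X} {g : (Fin m ⊕ Fin n → X) → k}
    (hgc : ∀ p, g (collapse s x₀ p) = g p) {p q : Fin m ⊕ Fin n → X} (hp : L.Generic p)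
    (hq : L.Generic q) {i : Fin m} {j : Fin n} (hpij : p (Sum.inl i) = p (Sum.inr j))
    (hqij : q (Sum.inl i) = q (Sum.inr j))
    (h : ∀ v, v ≠ Sum.inl i → v ≠ Sum.inr j → p v = q v) :
    weight s (L.xs p) (L.ys p) * g p = weight s (L.xs q) (L.ys q) * g q := by
  have hp' : L.xs p i = L.ys p j := congrArg L.coord hpij
  have hq' : L.xs q i = L.ys q j := congrArg L.coord hqij
  by_cases hij : (i : ℕ) < s ∧ (j : ℕ) < s
  · have hc : collapse s x₀ p = collapse s x₀ q := by
      ext v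
      by_cases h1 : v = Sum.inl i
      · simp [collapse, h1, hij.1]
      · by_cases h2 : v = Sum.inr j
        · simp [collapse, h2, hij.2]
        · simp [collapse, h v h1 h2]
    rw [← hgc p, hc, hgc q]
    congr 1
    refine weight_congr (i := i) (j := j) (fun a ha => ?_) (fun b hb => ?_) hp' hq' hp.xs hq.xs
      hp.ys hq.ys
    · exact congrArg L.coord (h _ (by simpa using ha) (by simp))
    · exact congrArg L.coord (h _ (by simp) (by simpa using hb))
  · rw [weight_eq_zero hp' hij, weight_eq_zero hq' hij, zero_mul, zero_mul]

/-- The sum over `S_m × S_n` of the translates of the weight times a function on the stratum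
becomes a supersymmetric regular function. -/
theorem exists_superFun_eq_sum [Infinite X] [CharZero k] (s : ℕ) (x₀ : X)
    {g : (Fin m ⊕ Fin n → X) → k} (hg : g ∈ regular L.gens (Fin m ⊕ Fin n))
    (hgc : ∀ p, g (collapse s x₀ p) = g p) :
    ∃ f ∈ L.superFun m n, ∀ p, L.Generic p → f p =
      ∑ στ : Equiv.Perm (Fin m) × Equiv.Perm (Fin n),
        weight s (L.xs p ∘ στ.1) (L.ys p ∘ στ.2) * g (p ∘ perm στ.1 στ.2) := by
  obtain ⟨f, hf, hFf⟩ := L.exists_eq_vand_mul (L.altSum_mem s hg) (L.altSum_comp_perm s g)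
  have hval : ∀ p, L.Generic p → f p =
      ∑ στ : Equiv.Perm (Fin m) × Equiv.Perm (Fin n),
        weight s (L.xs p ∘ στ.1) (L.ys p ∘ στ.2) * g (p ∘ perm στ.1 στ.2) := fun p hp =>
    mul_left_cancel₀ hp ((hFf p).symm.trans (L.altSum_eq hp))
  refine ⟨f, ⟨hf, fun σ τ p => ?_, fun i j p q hp hq h => ?_⟩, hval⟩
  · obtain ⟨r, hr⟩ := L.exists_generic (m := m) (n := n)
    refine sub_eq_zero.1 (L.eq_zero_of_mul (f := fun p => f (p ∘ perm σ τ) - f p)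
      (sub_mem (L.comp_mem (isCoordMap_reindex (perm σ τ)) hf) hf) L.vand_mul_vand_mem hr
      (fun p hp => ?_) p)
    rw [hval p hp, hval _ (Generic.comp_perm hp σ τ), sub_eq_zero]
    refine Fintype.sum_equiv (Equiv.mulLeft ((σ, τ) : Equiv.Perm (Fin m) × Equiv.Perm (Fin n)))
      _ _ fun στ => ?_
    simp only [Equiv.coe_mulLeft, Prod.fst_mul, Prod.snd_mul, comp_perm_mul]
    rfl
  -- The points `p` and `q` need not be generic. With `t` and `u` fixed, both sides become regular
  -- functions of the other coordinates, equal wherever both modified points are generic, and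
  -- density applies.
  · set t := p (Sum.inl i)
    set u := q (Sum.inl i)
    have hpt : setPair i j t p = p := setPair_eq hp fun _ _ _ => rfl
    have hqu : setPair i j u p = q := setPair_eq hq h
    obtain ⟨r, hr, hr'⟩ := exists_injective_avoiding (m := m) (n := n) t u
    have hr1 : L.Generic (setPair i j t r) := L.generic_setPair hr fun v => (hr' v).1
    have hr2 : L.Generic (setPair i j u r) := L.generic_setPair hr fun v => (hr' v).2
    have key := L.eq_zero_of_mul (f := fun r => f (setPair i j t r) - f (setPair i j u r))
      (sub_mem (L.comp_mem (isCoordMap_setPair i j t) hf)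
        (L.comp_mem (isCoordMap_setPair i j u) hf))
      (mul_mem (L.comp_mem (isCoordMap_setPair i j t) L.vand_mul_vand_mem)
        (L.comp_mem (isCoordMap_setPair i j u) L.vand_mul_vand_mem))
      (mul_ne_zero hr1 hr2) (fun r hr => ?_) p
    · simpa only [hpt, hqu, sub_eq_zero] using key
    have h1 : L.Generic (setPair i j t r) := left_ne_zero_of_mul hr
    have h2 : L.Generic (setPair i j u r) := right_ne_zero_of_mul hr
    rw [hval _ h1, hval _ h2, sub_eq_zero]
    refine Finset.sum_congr rfl fun στ _ => ?_
    change weight s (L.xs (setPair i j t r ∘ perm στ.1 στ.2))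
        (L.ys (setPair i j t r ∘ perm στ.1 στ.2)) * _ =
      weight s (L.xs (setPair i j u r ∘ perm στ.1 στ.2))
        (L.ys (setPair i j u r ∘ perm στ.1 στ.2)) * _
    refine L.weight_mul_congr hgc (h1.comp_perm στ.1 στ.2) (h2.comp_perm στ.1 στ.2)
      (i := στ.1⁻¹ i) (j := στ.2⁻¹ j) (by simp [perm, setPair]) (by simp [perm, setPair]) ?_
    rintro (a | b) ha hb
    · have : στ.1 a ≠ i := by
        rintro rfl
        simp at ha
      simp [perm, setPair, this]
    · have : στ.2 b ≠ j := by
        rintro rfl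
        simp at hb
      simp [perm, setPair, this]

/-- A supersymmetric function does not depend on the variables `x_i = y_i` that cancel. -/
theorem superFun_collapse {f : (Fin m ⊕ Fin n → X) → k} (hf : f ∈ L.superFun m n) {s : ℕ}
    (hm : s ≤ m) (hn : s ≤ n) (x₀ : X) {p : Fin m ⊕ Fin n → X}
    (hp : ∀ (i : Fin m) (j : Fin n), (i : ℕ) = j → (i : ℕ) < s → p (Sum.inl i) = p (Sum.inr j)) :
    f (collapse s x₀ p) = f p := by
  induction s with
  | zero => rw [collapse_zero]
  | succ s ih =>
    rw [← ih (by omega) (by omega) fun i j hij hi => hp i j hij (by omega)]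
    -- With indices counted from zero, the two collapsed points differ at most in the pair with
    -- index `s`.
    refine hf.2.2 ⟨s, hm⟩ ⟨s, hn⟩ _ _ (by simp [collapse]) ?_ ?_
    · simpa [collapse] using hp ⟨s, hm⟩ ⟨s, hn⟩ rfl (by simp)
    · rintro (a | b) ha hb
      · have : ((a : ℕ) < s + 1 ↔ (a : ℕ) < s) := by
          have : (a : ℕ) ≠ s := fun e => ha (by simp [← e])
          omega
        exact if_congr this rfl rfl
      · have : ((b : ℕ) < s + 1 ↔ (b : ℕ) < s) := by
          have : (b : ℕ) ≠ s := fun e => hb (by simp [← e])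
          omega
        exact if_congr this rfl rfl

/-- The point of the stratum obtained by replacing `y_j` by `x_j` for `j < s`. -/
def toStratum {X : Type*} {s : ℕ} (hm : s ≤ m) (p : Fin m ⊕ Fin n → X) : Fin m ⊕ Fin n → X :=
  Sum.elim (p ∘ Sum.inl) fun j =>
    if h : (j : ℕ) < s then p (Sum.inl ⟨j, h.trans_le hm⟩) else p (Sum.inr j)

theorem isCoordMap_toStratum {X : Type*} {s : ℕ} (hm : s ≤ m) :
    IsCoordMap (toStratum (X := X) (n := n) hm) := by
  rintro (a | b)
  · exact Or.inl ⟨Sum.inl a, fun p => rfl⟩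
  · by_cases h : (b : ℕ) < s
    · exact Or.inl ⟨Sum.inl ⟨b, h.trans_le hm⟩, fun p => by simp [toStratum, h]⟩
    · exact Or.inl ⟨Sum.inr b, fun p => by simp [toStratum, h]⟩

theorem collapse_toStratum {X : Type*} {s : ℕ} (hm : s ≤ m) (x₀ : X) (p : Fin m ⊕ Fin n → X) :
    collapse s x₀ (toStratum hm p) = collapse s x₀ p := by
  ext v
  rcases v with a | b
  · simp [collapse, toStratum]
  · by_cases h : (b : ℕ) < s <;> simp [collapse, toStratum, h]

theorem highRes_collapse (s : ℕ) (x₀ : X) (p : Fin m ⊕ Fin n → X) :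
    highRes s (L.xs (collapse s x₀ p)) (L.ys (collapse s x₀ p)) = highRes s (L.xs p) (L.ys p) := by
  refine Finset.prod_congr rfl fun a _ => Finset.prod_congr rfl fun b _ => ?_
  split_ifs with h
  · simp [xs, ys, collapse, h.1.not_gt, h.2.not_gt]
  · rfl

/-- A permutation that moves part of some low pair `x_i = y_i` to a high place has weight zero
there. The remaining permutations all contribute the same term. -/
theorem sum_weight_toStratum {s : ℕ} (hm : s ≤ m) (hn : s ≤ n)
    {g : (Fin m ⊕ Fin n → X) → k}
    (hgs : ∀ (σ : Equiv.Perm (Fin m)) (τ : Equiv.Perm (Fin n)), PreservesLow s σ →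
      PreservesLow s τ → ∀ p, g (p ∘ perm σ τ) = g p) {p : Fin m ⊕ Fin n → X}
    (hp : L.Generic p)
    (hps : ∀ (i : Fin m) (j : Fin n), (i : ℕ) = j → (i : ℕ) < s → p (Sum.inl i) = p (Sum.inr j)) :
    ∑ στ : Equiv.Perm (Fin m) × Equiv.Perm (Fin n),
        weight s (L.xs p ∘ στ.1) (L.ys p ∘ στ.2) * g (p ∘ perm στ.1 στ.2) =
      (Nat.card {στ : Equiv.Perm (Fin m) × Equiv.Perm (Fin n) //
        PreservesLow s στ.1 ∧ PreservesLow s στ.2} : k) *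
        (highRes s (L.xs p) (L.ys p) * g p) := by
  classical
  have hps' : ∀ (i : Fin m) (j : Fin n), (i : ℕ) = j → (i : ℕ) < s → L.xs p i = L.ys p j :=
    fun i j hij hi => congrArg L.coord (hps i j hij hi)
  have key : ∀ στ : Equiv.Perm (Fin m) × Equiv.Perm (Fin n),
      weight s (L.xs p ∘ στ.1) (L.ys p ∘ στ.2) * g (p ∘ perm στ.1 στ.2) =
        if PreservesLow s στ.1 ∧ PreservesLow s στ.2 then
          highRes s (L.xs p) (L.ys p) * g p else 0 := by
    rintro ⟨σ, τ⟩
    split_ifs with h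
    · rw [weight_comp_perm _ _ h.1 h.2, hgs σ τ h.1 h.2, weight_eq_highRes hm hn hp.xs hp.ys hps']
    -- If both inverses sent all low indices to low indices, then by finiteness `σ` and `τ` would
    -- preserve the low sets.
    · have hne : ∃ (i : Fin m) (j : Fin n), (i : ℕ) = j ∧ (i : ℕ) < s ∧
          ¬((σ⁻¹ i : ℕ) < s ∧ (τ⁻¹ j : ℕ) < s) := by
        by_contra! hcon
        have hfin : ∀ {l : ℕ} (π : Equiv.Perm (Fin l)),
            (∀ a : Fin l, (a : ℕ) < s → (π⁻¹ a : ℕ) < s) → PreservesLow s π := by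
          intro l π hπ a
          refine ⟨fun h => by simpa using hπ _ h, fun h => ?_⟩
          have hsub : (π⁻¹ : Equiv.Perm (Fin l)) '' {a | (a : ℕ) < s} ⊆ {a | (a : ℕ) < s} := by
            rintro _ ⟨b, hb, rfl⟩
            exact hπ b hb
          have heq := Set.eq_of_subset_of_ncard_le hsub
            (Set.ncard_image_of_injective _ (π⁻¹).injective).ge (Set.toFinite _)
          obtain ⟨b, hb, rfl⟩ : a ∈ (π⁻¹ : Equiv.Perm (Fin l)) '' {a | (a : ℕ) < s} := by
            rw [heq]
            exact h
          simpa using hb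
        refine h ⟨hfin σ fun a ha => ?_, hfin τ fun b hb => ?_⟩
        · exact (hcon a ⟨a, ha.trans_le hn⟩ rfl ha).1
        · exact (hcon ⟨b, hb.trans_le hm⟩ b rfl hb).2
      obtain ⟨i, j, hij, hi, hlow⟩ := hne
      rw [weight_eq_zero (i := σ⁻¹ i) (j := τ⁻¹ j) (by simpa using hps' i j hij hi) hlow, zero_mul]
  rw [Finset.sum_congr rfl fun στ _ => key στ, ← Finset.sum_filter, Finset.sum_const,
    nsmul_eq_mul, Nat.card_eq_fintype_card, Fintype.card_subtype]

/-- Every invariant function on a stratum becomes the restriction of a supersymmetric function when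
it is multiplied by the product of the remaining `x_a - y_b`. -/
theorem exists_superFun_collapse [Infinite X] [CharZero k] {s : ℕ} (hm : s ≤ m) (hn : s ≤ n)
    (x₀ : X) {g : (Fin m ⊕ Fin n → X) → k} (hg : g ∈ regular L.gens (Fin m ⊕ Fin n))
    (hgc : ∀ p, g (collapse s x₀ p) = g p)
    (hgs : ∀ (σ : Equiv.Perm (Fin m)) (τ : Equiv.Perm (Fin n)), PreservesLow s σ →
      PreservesLow s τ → ∀ p, g (p ∘ perm σ τ) = g p) :
    ∃ f ∈ L.superFun m n, ∀ p,
      f (collapse s x₀ p) = highRes s (L.xs p) (L.ys p) * g p := by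
  obtain ⟨f, hf, hval⟩ := L.exists_superFun_eq_sum s x₀ hg hgc
  set N := Nat.card {στ : Equiv.Perm (Fin m) × Equiv.Perm (Fin n) //
        PreservesLow s στ.1 ∧ PreservesLow s στ.2} with hN
  have hN0 : (N : k) ≠ 0 := by
    have : Nonempty {στ : Equiv.Perm (Fin m) × Equiv.Perm (Fin n) //
        PreservesLow s στ.1 ∧ PreservesLow s στ.2} :=
      ⟨⟨(1, 1), fun _ => Iff.rfl, fun _ => Iff.rfl⟩⟩
    exact Nat.cast_ne_zero.2 Nat.card_pos.ne'
  refine ⟨(N : k)⁻¹ • f, Subalgebra.smul_mem _ hf _, fun p => ?_⟩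
  have hstr : ∀ (p : Fin m ⊕ Fin n → X) (i : Fin m) (j : Fin n), (i : ℕ) = j → (i : ℕ) < s →
      toStratum hm p (Sum.inl i) = toStratum hm p (Sum.inr j) := by
    intro p i j hij hi
    have hj : (j : ℕ) < s := hij ▸ hi
    simp only [toStratum, Sum.elim_inl, Sum.elim_inr, hj, dif_pos, comp_apply]
    congr 2
    exact Fin.ext hij
  have hres : ∀ p, highRes s (L.xs (toStratum hm p)) (L.ys (toStratum hm p)) * g (toStratum hm p) =
      highRes s (L.xs p) (L.ys p) * g p := by
    intro p
    rw [← L.highRes_collapse s x₀, ← hgc (toStratum hm p), collapse_toStratum, hgc,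
      L.highRes_collapse]
  obtain ⟨r, hr, -⟩ := exists_injective_avoiding (m := m) (n := n) x₀ x₀
  have hr' : L.Generic (toStratum hm r) := by
    refine L.generic_of_injective (hr.comp Sum.inl_injective) fun a b hab => ?_
    simp only [toStratum, comp_apply, Sum.elim_inr] at hab
    split_ifs at hab with h1 h2 h2
    · simpa [Fin.ext_iff] using hr hab
    · simpa using hr hab
    · simpa using hr hab
    · simpa using hr hab
  -- The sum formula for `f` is known only at generic points. The stratum contains some, so the
  -- identity spreads to all of it by density.
  have key := L.eq_zero_of_mul (f := fun p => f (toStratum hm p) -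
      N * (highRes s (L.xs p) (L.ys p) * g p))
    (sub_mem (L.comp_mem (isCoordMap_toStratum hm) hf.1)
      (mul_mem (L.const_mem _) (mul_mem (L.highRes_mem s) hg)))
    (L.comp_mem (isCoordMap_toStratum hm) L.vand_mul_vand_mem) hr' (fun p hp => by
      rw [hval _ hp, L.sum_weight_toStratum hm hn hgs hp (hstr p), hres, sub_self]) p
  have hfp : f (collapse s x₀ p) = f (toStratum hm p) := by
    rw [← collapse_toStratum hm, L.superFun_collapse hf hm hn x₀ (hstr p)]
  rw [Pi.smul_apply, hfp, sub_eq_zero.1 key, smul_eq_mul, inv_mul_cancel_left₀ hN0]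

end LineModel

/-! ### Points of the algebra of regular functions, invariants, and the choice of a stratum. -/

/-- Hilbert's Nullstellensatz: a maximal ideal of a finitely generated algebra over an
algebraically closed field is the kernel of a character. -/
theorem exists_algHom_mem_iff {k B : Type*} [Field k] [IsAlgClosed k] [CommRing B] [Algebra k B]
    [Algebra.FiniteType k B] (Q : Ideal B) [Q.IsMaximal] :
    ∃ χ : B →ₐ[k] k, ∀ b, b ∈ Q ↔ χ b = 0 := by
  let := Ideal.Quotient.field Q
  have : Module.Finite k (B ⧸ Q) := finite_of_finite_type_of_isJacobsonRing k (B ⧸ Q)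
  let e : k ≃ₐ[k] (B ⧸ Q) := AlgEquiv.ofBijective (Algebra.ofId k _)
    IsAlgClosed.algebraMap_bijective_of_isIntegral
  refine ⟨e.symm.toAlgHom.comp (Ideal.Quotient.mkₐ k Q), fun b => ?_⟩
  rw [← Ideal.Quotient.eq_zero_iff_mem]
  exact (map_eq_zero_iff e.symm e.symm.injective).symm

namespace LineModel

variable {k X : Type*} [Field k] (L : LineModel k X) {m n : ℕ} {σ : Type*}

theorem comp_eval_mem {r : X → k} (hr : r ∈ Algebra.adjoin k L.gens) (v : σ) :
    (fun p : σ → X => r (p v)) ∈ regular L.gens σ := by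
  induction hr using Algebra.adjoin_induction with
  | mem r h => exact L.gen_mem h v
  | algebraMap c => exact L.const_mem c
  | add f g _ _ hf hg => exact add_mem hf hg
  | mul f g _ _ hf hg => exact mul_mem hf hg

/-- The inclusion of the functions of the coordinate `v` into the regular functions. -/
def ofCoord (v : σ) : Algebra.adjoin k L.gens →ₐ[k] regular L.gens σ where
  toFun r := ⟨fun p => r.1 (p v), L.comp_eval_mem r.2 v⟩
  map_one' := rfl
  map_mul' _ _ := rfl
  map_zero' := rfl
  map_add' _ _ := rfl
  commutes' _ := rfl

/-- The restriction of a character to the functions of one coordinate is a point of `X`, and these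
functions together generate the algebra. -/
theorem exists_eq_eval (χ : regular L.gens σ →ₐ[k] k) :
    ∃ p : σ → X, ∀ f : regular L.gens σ, χ f = f.1 p := by
  choose p hp using fun v => L.exists_point (χ.comp (L.ofCoord v))
  refine ⟨p, fun ⟨f, hf⟩ => ?_⟩
  induction hf using Algebra.adjoin_induction with
  | mem f h =>
    obtain ⟨v, r, hr, rfl⟩ := h
    exact hp v r hr
  | algebraMap c => exact χ.commutes c
  | add f g hf' hg' hf hg =>
    exact (map_add χ ⟨f, hf'⟩ ⟨g, hg'⟩).trans (congrArg₂ (· + ·) hf hg)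
  | mul f g hf' hg' hf hg =>
    exact (map_mul χ ⟨f, hf'⟩ ⟨g, hg'⟩).trans (congrArg₂ (· * ·) hf hg)

theorem finiteType_regular [Finite σ] : Algebra.FiniteType k (regular L.gens σ) := by
  refine Subalgebra.fg_iff_finiteType _ |>.1 ?_
  have : {f : (σ → X) → k | ∃ v, ∃ r ∈ L.gens, f = fun p => r (p v)}.Finite := by
    refine ((Set.finite_univ (α := σ)).image2 (fun v r => fun p : σ → X => r (p v))
      L.finite_gens).subset ?_
    rintro _ ⟨v, r, hr, rfl⟩
    exact ⟨v, trivial, r, hr, rfl⟩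
  exact Subalgebra.fg_def.2 ⟨_, this, rfl⟩

/-- The Nullstellensatz for the algebra of regular functions. -/
theorem exists_mem_iff_eval [IsAlgClosed k] [Finite σ] (Q : Ideal (regular L.gens σ))
    [hQ : Q.IsMaximal] : ∃ p : σ → X, ∀ f : regular L.gens σ, f ∈ Q ↔ f.1 p = 0 := by
  have := L.finiteType_regular (σ := σ)
  obtain ⟨χ, hχ⟩ := exists_algHom_mem_iff (k := k) Q
  obtain ⟨p, hp⟩ := L.exists_eq_eval χ
  exact ⟨p, fun f => by rw [hχ, hp]⟩

/-- The permutations that preserve the set of indices below `s`. -/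
def lowPerms (m n s : ℕ) : Subgroup (Equiv.Perm (Fin m) × Equiv.Perm (Fin n)) where
  carrier := {π | PreservesLow s π.1 ∧ PreservesLow s π.2}
  mul_mem' := by
    rintro π ρ ⟨h1, h2⟩ ⟨h3, h4⟩
    exact ⟨fun a => (h1 _).trans (h3 a), fun a => (h2 _).trans (h4 a)⟩
  one_mem' := ⟨fun _ => Iff.rfl, fun _ => Iff.rfl⟩
  inv_mem' := by
    rintro π ⟨h1, h2⟩
    exact ⟨fun a => by simpa using (h1 (π.1⁻¹ a)).symm, fun a => by simpa using (h2 (π.2⁻¹ a)).symm⟩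

instance permAction (s : ℕ) :
    MulSemiringAction (lowPerms m n s) (regular L.gens (Fin m ⊕ Fin n)) where
  smul π f := ⟨fun p => f.1 (p ∘ perm π.1.1 π.1.2), L.comp_mem (isCoordMap_reindex _) f.2⟩
  one_smul f := Subtype.ext (funext fun p => congrArg f.1 (comp_perm_one p))
  mul_smul π ρ f := Subtype.ext (funext fun p => congrArg f.1
    (comp_perm_mul p π.1.1 ρ.1.1 π.1.2 ρ.1.2))
  smul_zero _ := rfl
  smul_add _ _ _ := rfl
  smul_one _ := rfl
  smul_mul _ _ _ := rfl

theorem smul_apply {s : ℕ} (π : lowPerms m n s) (f : regular L.gens (Fin m ⊕ Fin n))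
    (p : Fin m ⊕ Fin n → X) : (π • f).1 p = f.1 (p ∘ perm π.1.1 π.1.2) := rfl

/-- The regular functions that are invariant under the permutations which preserve the set of
indices below `s`. -/
abbrev lowInvariants (m n s : ℕ) : Subring (regular L.gens (Fin m ⊕ Fin n)) :=
  FixedPoints.subring (regular L.gens (Fin m ⊕ Fin n)) (lowPerms m n s)

theorem isIntegral_lowInvariants (s : ℕ) :
    Algebra.IsIntegral (L.lowInvariants m n s) (regular L.gens (Fin m ⊕ Fin n)) := by
  have : Algebra.IsInvariant (L.lowInvariants m n s) (regular L.gens (Fin m ⊕ Fin n))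
      (lowPerms m n s) := ⟨fun b hb => ⟨⟨b, hb⟩, rfl⟩⟩
  exact Algebra.IsInvariant.isIntegral (L.lowInvariants m n s) (regular L.gens (Fin m ⊕ Fin n))
    (lowPerms m n s)

theorem exists_highRes_ne_zero [Infinite X] (s : ℕ) :
    ∃ p : Fin m ⊕ Fin n → X, highRes s (L.xs p) (L.ys p) ≠ 0 := by
  obtain ⟨t⟩ : Nonempty X := inferInstance
  obtain ⟨r, hr, -⟩ := exists_injective_avoiding (m := m) (n := n) t t
  refine ⟨r, Finset.prod_ne_zero_iff.2 fun a _ => Finset.prod_ne_zero_iff.2 fun b _ => ?_⟩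
  split_ifs
  · exact sub_ne_zero.2 fun e => by simpa using hr (L.coord_injective e)
  · exact one_ne_zero

/-- A supersymmetric function that vanishes on the next stratum is divisible by the product of the
remaining `x_a - y_b` on the given one. -/
theorem exists_collapse_eq_highRes_mul [Infinite X] {f : (Fin m ⊕ Fin n → X) → k}
    (hf : f ∈ L.superFun m n) {s : ℕ} (hm : s < m) (hn : s < n) {x₀ : X}
    (h : ∀ p, f (collapse (s + 1) x₀ p) = 0) :
    ∃ b ∈ regular L.gens (Fin m ⊕ Fin n), (∀ p, b (collapse s x₀ p) = b p) ∧
      (∀ (σ : Equiv.Perm (Fin m)) (τ : Equiv.Perm (Fin n)), PreservesLow s σ →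
        PreservesLow s τ → ∀ p, b (p ∘ perm σ τ) = b p) ∧
      ∀ p, f (collapse s x₀ p) = highRes s (L.xs p) (L.ys p) * b p := by
  have hfc := L.comp_mem (isCoordMap_collapse s x₀) hf.1
  obtain ⟨b, hb, hfb⟩ := L.exists_eq_prod_diff_mul
    (Finset.univ.filter fun e : Fin m × Fin n => s ≤ e.1 ∧ s ≤ e.2)
    (fun e => Sum.inl e.1) (fun e => Sum.inr e.2) (by simp)
    (by
      rintro ⟨i, j⟩ - ⟨i', j'⟩ - hne
      simpa using hne) hfc (by
      rintro ⟨a, b⟩ hab p hp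
      have ha : s ≤ a := (Finset.mem_filter.1 hab).2.1
      have hb : s ≤ b := (Finset.mem_filter.1 hab).2.2
      -- Symmetry moves the coinciding pair `(a, b)` to the place with index `s`, which puts the
      -- point on the next stratum, where `f` vanishes.
      rw [← hf.2.1 (Equiv.swap a ⟨s, hm⟩) (Equiv.swap b ⟨s, hn⟩)]
      rw [← L.superFun_collapse hf hm hn x₀, h]
      intro i j hij hi
      simp only [comp_apply, perm, Sum.map_inl, Sum.map_inr]
      by_cases his : (i : ℕ) = s
      · rw [show i = ⟨s, hm⟩ from Fin.ext his, show j = ⟨s, hn⟩ from Fin.ext (hij ▸ his),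
          Equiv.swap_apply_right, Equiv.swap_apply_right]
        simpa [collapse, ha.not_gt, hb.not_gt] using hp
      · rw [Equiv.swap_apply_of_ne_of_ne (fun e => by subst e; omega)
          (fun e => his (congrArg Fin.val e)),
          Equiv.swap_apply_of_ne_of_ne (fun e => by subst e; omega)
          (fun e => his (hij.trans (congrArg Fin.val e)))]
        have h1 : (i : ℕ) < s := by omega
        have h2 : (j : ℕ) < s := by omega
        simp [collapse, h1, h2])
  have hfb' : ∀ p, f (collapse s x₀ p) = highRes s (L.xs p) (L.ys p) * b p := by
    intro p
    rw [hfb, highRes]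
    simp only [Finset.prod_filter, Fintype.prod_prod_type]
    rfl
  -- The quotient `b` may depend on the low coordinates. Its composite with `collapse` is an equally
  -- good quotient that does not.
  have hfb'' : ∀ p, f (collapse s x₀ p) = highRes s (L.xs p) (L.ys p) * b (collapse s x₀ p) := by
    intro p
    rw [← L.highRes_collapse s x₀, ← hfb', collapse_collapse]
  refine ⟨fun p => b (collapse s x₀ p), L.comp_mem (isCoordMap_collapse s x₀) hb,
    fun p => congrArg b (collapse_collapse s x₀ p), fun σ τ hσ hτ p => ?_, hfb''⟩
  -- The invariance of the quotient follows from that of `f` and `highRes` where `highRes` is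
  -- nonzero, and then everywhere by density.
  obtain ⟨q, hq⟩ := L.exists_highRes_ne_zero (m := m) (n := n) s
  have hbc := L.comp_mem (isCoordMap_collapse s x₀) hb
  refine sub_eq_zero.1 (L.eq_zero_of_mul
    (f := fun p => b (collapse s x₀ (p ∘ perm σ τ)) - b (collapse s x₀ p))
    (sub_mem (L.comp_mem (isCoordMap_reindex (perm σ τ)) hbc) hbc) (L.highRes_mem s) hq
    (fun p hp => ?_) p)
  have h1 := hfb'' (p ∘ perm σ τ)
  change _ = highRes s (L.xs p ∘ σ) (L.ys p ∘ τ) * _ at h1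
  rw [highRes_comp_perm _ _ hσ hτ, collapse_comp_perm x₀ p hσ hτ, hf.2.1, hfb'',
    ← collapse_comp_perm x₀ p hσ hτ] at h1
  exact sub_eq_zero.2 (mul_left_cancel₀ hp h1).symm

/-- For every maximal ideal there is a last stratum such that the ideal contains all functions that
vanish on the stratum. -/
theorem exists_stratum [Infinite X] (x₀ : X) (M : Ideal (L.superFun m n)) (hM : M ≠ ⊤) :
    ∃ s ≤ m, s ≤ n ∧ (∀ f : L.superFun m n, (∀ p, f.1 (collapse s x₀ p) = 0) → f ∈ M) ∧
      ∃ f : L.superFun m n, f ∉ M ∧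
        ∃ b ∈ regular L.gens (Fin m ⊕ Fin n), (∀ p, b (collapse s x₀ p) = b p) ∧
        (∀ (σ : Equiv.Perm (Fin m)) (τ : Equiv.Perm (Fin n)), PreservesLow s σ →
          PreservesLow s τ → ∀ p, b (p ∘ perm σ τ) = b p) ∧
        ∀ p, f.1 (collapse s x₀ p) = highRes s (L.xs p) (L.ys p) * b p := by
  let P : ℕ → Prop := fun s => ∀ f : L.superFun m n, (∀ p, f.1 (collapse s x₀ p) = 0) → f ∈ M
  have h0 : P 0 := by
    intro f hf
    have : f = 0 := Subtype.ext (funext fun p => by simpa [collapse_zero] using hf p)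
    exact this ▸ M.zero_mem
  by_cases hs : ∃ s, s < m ∧ s < n ∧ P s ∧ ¬P (s + 1)
  · obtain ⟨s, hm, hn, hs, hs'⟩ := hs
    simp only [P, not_forall] at hs'
    obtain ⟨f, hf, hfM⟩ := hs'
    exact ⟨s, hm.le, hn.le, hs, f, hfM, L.exists_collapse_eq_highRes_mul f.2 hm hn hf⟩
  · push Not at hs
    have hP : ∀ s, s ≤ m → s ≤ n → P s := by
      intro s
      induction s with
      | zero => exact fun _ _ => h0
      | succ s ih => exact fun hm hn => hs s hm hn (ih (by omega) (by omega))
    -- At the final level no pair of high indices remains, so `highRes` is an empty product and `f =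
    -- b = 1` serves.
    refine ⟨min m n, min_le_left _ _, min_le_right _ _, hP _ (min_le_left _ _) (min_le_right _ _),
      1, fun h => hM ((Ideal.eq_top_iff_one M).2 h), 1, one_mem _, fun _ => rfl,
      fun _ _ _ _ _ => rfl, fun p => ?_⟩
    have : highRes (min m n) (L.xs p) (L.ys p) = 1 := by
      refine Finset.prod_eq_one fun a _ => Finset.prod_eq_one fun b _ => if_neg ?_
      omega
    simp [this]

end LineModel

/-! ### The Nullstellensatz for supersymmetric functions. -/

namespace LineModel

variable {k X : Type*} [Field k] (L : LineModel k X) {m n : ℕ}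

/-- Restrictions to the stratum determine classes modulo `M`. An invariant `g` need not extend to a
supersymmetric function, but its product with `highRes * b`, the restriction of `f₀`, does. Since
`f₀` is invertible modulo `M`, one can divide by its class. -/
theorem exists_ringHom_lowInvariants [Infinite X] [CharZero k] (M : Ideal (L.superFun m n))
    [hM : M.IsMaximal] :
    ∃ (s : ℕ) (ψ : L.lowInvariants m n s →+* L.superFun m n ⧸ M),
      ∀ (f : L.superFun m n) (g : L.lowInvariants m n s), g.1.1 = f.1 →
        ψ g = Ideal.Quotient.mk M f := by
  obtain ⟨x₀⟩ : Nonempty X := inferInstance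
  obtain ⟨s, hm, hn, hK, f₀, hf₀, b, hb, hbc, hbs, hfb⟩ := L.exists_stratum x₀ M hM.ne_top
  let := Ideal.Quotient.field M
  refine ⟨s, ?_⟩
  have hmk : ∀ f f' : L.superFun m n, (∀ p, f.1 (collapse s x₀ p) = f'.1 (collapse s x₀ p)) →
      Ideal.Quotient.mk M f = Ideal.Quotient.mk M f' := fun f f' h =>
    Ideal.Quotient.eq.2 (hK _ fun p => sub_eq_zero.2 (h p))
  have hlift : ∀ g : L.lowInvariants m n s, ∃ f : L.superFun m n, ∀ p,
      f.1 (collapse s x₀ p) =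
        highRes s (L.xs p) (L.ys p) * (b p * g.1.1 (collapse s x₀ p)) := by
    intro g
    have hg : ∀ (σ : Equiv.Perm (Fin m)) (τ : Equiv.Perm (Fin n)) (_ : PreservesLow s σ)
        (_ : PreservesLow s τ) (p), g.1.1 (p ∘ perm σ τ) = g.1.1 p := fun σ τ hσ hτ p =>
      congrFun (congrArg Subtype.val (g.2 ⟨(σ, τ), hσ, hτ⟩)) p
    obtain ⟨f, hf, h⟩ := L.exists_superFun_collapse hm hn x₀
      (g := fun p => b p * g.1.1 (collapse s x₀ p))
      (mul_mem hb (L.comp_mem (isCoordMap_collapse s x₀) g.1.2))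
      (fun p => by simp only [hbc, collapse_collapse])
      (fun σ τ hσ hτ p => by
        simp only [hbs σ τ hσ hτ, collapse_comp_perm x₀ p hσ hτ, hg σ τ hσ hτ])
    exact ⟨⟨f, hf⟩, h⟩
  choose l hl using hlift
  set φ := Ideal.Quotient.mk M
  have h₀ : φ f₀ ≠ 0 := fun h => hf₀ (Ideal.Quotient.eq_zero_iff_mem.1 h)
  let ψ : L.lowInvariants m n s →+* L.superFun m n ⧸ M :=
    { toFun := fun g => φ (l g) / φ f₀
      map_one' := by
        rw [div_eq_one_iff_eq h₀]
        refine hmk _ _ fun p => ?_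
        rw [hl, hfb]
        change _ * (_ * 1) = _
        rw [mul_one]
      map_mul' := fun g h => by
        rw [div_mul_div_comm, div_eq_div_iff h₀ (mul_ne_zero h₀ h₀), ← map_mul, ← map_mul,
          ← map_mul, ← map_mul]
        refine hmk _ _ fun p => ?_
        change (l (g * h)).1 _ * (f₀.1 _ * f₀.1 _) = (l g).1 _ * (l h).1 _ * f₀.1 _
        rw [hl, hl, hl, hfb]
        change _ * (_ * (g.1.1 _ * h.1.1 _)) * _ = _
        ring
      map_zero' := by
        rw [div_eq_zero_iff]
        left
        rw [← map_zero φ]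
        refine hmk _ _ fun p => ?_
        rw [hl]
        change _ * (_ * 0) = 0
        ring
      map_add' := fun g h => by
        rw [← add_div, ← map_add]
        congr 1
        refine hmk _ _ fun p => ?_
        change (l (g + h)).1 _ = (l g).1 _ + (l h).1 _
        rw [hl, hl, hl]
        change _ * (_ * (g.1.1 _ + h.1.1 _)) = _
        ring }
  refine ⟨ψ, fun f g hgf => ?_⟩
  change φ (l g) / φ f₀ = φ f
  rw [div_eq_iff h₀, ← map_mul]
  refine hmk _ _ fun p => ?_
  change (l g).1 _ = f.1 _ * f₀.1 _
  rw [hl, hfb, hgf]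
  ring

/-- The weak Nullstellensatz for supersymmetric regular functions. -/
theorem exists_superFun_mem_iff_eval [Infinite X] [IsAlgClosed k] [CharZero k]
    (M : Ideal (L.superFun m n)) [hM : M.IsMaximal] :
    ∃ p : Fin m ⊕ Fin n → X, ∀ f : L.superFun m n, f ∈ M ↔ f.1 p = 0 := by
  obtain ⟨s, ψ, hψ⟩ := L.exists_ringHom_lowInvariants M
  let := Ideal.Quotient.field M
  let j : L.superFun m n → L.lowInvariants m n s := fun f =>
    ⟨⟨f.1, f.2.1⟩, fun π => Subtype.ext (funext fun p => f.2.2.1 _ _ p)⟩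
  -- The supersymmetric functions alone already fill the quotient field, so the kernel of `ψ` is
  -- maximal.
  have hsurj : Surjective ψ := by
    intro y
    obtain ⟨f, rfl⟩ := Ideal.Quotient.mk_surjective y
    exact ⟨j f, hψ f (j f) rfl⟩
  have hmax : (RingHom.ker ψ).IsMaximal := RingHom.ker_isMaximal_of_surjective ψ hsurj
  have := L.isIntegral_lowInvariants (m := m) (n := n) s
  obtain ⟨Q, hQ, hQψ⟩ := Ideal.exists_ideal_over_maximal_of_isIntegral
    (S := regular L.gens (Fin m ⊕ Fin n)) (RingHom.ker ψ) fun x hx => by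
      have : x = 0 := Subtype.ext hx
      rw [this]
      exact zero_mem _
  obtain ⟨p, hp⟩ := L.exists_mem_iff_eval Q
  refine ⟨p, fun f => ?_⟩
  rw [← Ideal.Quotient.eq_zero_iff_mem, ← hψ f (j f) rfl, ← RingHom.mem_ker, ← hQψ,
    Ideal.mem_comap]
  exact hp _

/-- The weak Nullstellensatz for an algebra that is isomorphic to the algebra of supersymmetric
regular functions. -/
theorem exists_mem_iff_of_range_eq [Infinite X] [IsAlgClosed k] [CharZero k] {A : Type*} [CommRing A]
    [Algebra k A] (ι : A →ₐ[k] ((Fin m ⊕ Fin n → X) → k)) (hι : Injective ι)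
    (hr : ι.range = L.superFun m n) (M : Ideal A) [hM : M.IsMaximal] :
    ∃ p : Fin m ⊕ Fin n → X, ∀ f : A, f ∈ M ↔ ι f p = 0 := by
  let e : A ≃ₐ[k] L.superFun m n :=
    (AlgEquiv.ofInjective ι hι).trans (Subalgebra.equivOfEq _ _ hr)
  have : (M.comap e.symm.toRingEquiv).IsMaximal := Ideal.comap_isMaximal_of_equiv e.symm.toRingEquiv
  obtain ⟨p, hp⟩ := L.exists_superFun_mem_iff_eval (M.comap e.symm.toRingEquiv)
  refine ⟨p, fun f => ?_⟩
  have h := hp (e f)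
  rw [Ideal.mem_comap] at h
  change e.symm (e f) ∈ M ↔ _ at h
  rwa [e.symm_apply_apply] at h

end LineModel

/-! ### Case S: polynomials as functions on powers of the affine line. -/

section Polynomial

variable (k : Type*) [Field k] {m n : ℕ}

/-- The affine line. -/
def affineLine : LineModel k k where
  coord := id
  gens := {id}
  coord_injective := injective_id
  coord_mem_gens := rfl
  finite_gens := Set.finite_singleton _
  finite_zeros r hr x hx := by
    have h : ∃ P : Polynomial k, ∀ x, r x = P.eval x := by
      clear hx
      induction hr using Algebra.adjoin_induction with
      | mem f h =>
        rw [Set.mem_singleton_iff.1 h]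
        exact ⟨Polynomial.X, by simp⟩
      | algebraMap c => exact ⟨Polynomial.C c, by simp⟩
      | add f g _ _ hf hg =>
        obtain ⟨P, hP⟩ := hf
        obtain ⟨Q, hQ⟩ := hg
        exact ⟨P + Q, by simp [hP, hQ]⟩
      | mul f g _ _ hf hg =>
        obtain ⟨P, hP⟩ := hf
        obtain ⟨Q, hQ⟩ := hg
        exact ⟨P * Q, by simp [hP, hQ]⟩
    obtain ⟨P, hP⟩ := h
    have h0 : P ≠ 0 := by
      rintro rfl
      simp [hP] at hx
    simp only [hP]
    exact Polynomial.finite_setOfPred_isRoot h0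
  exists_point χ := ⟨χ ⟨id, Algebra.subset_adjoin rfl⟩, by
    rintro r rfl
    rfl⟩
  divided_difference := by
    rintro r rfl
    exact ⟨1, one_mem _, by simp⟩

/-- A polynomial as the function `p ↦ f(x, -y)` with `p = (x, y)`. -/
noncomputable def polyToFun : PolyRing k m n →ₐ[k] ((Fin m ⊕ Fin n → k) → k) :=
  AlgHom.pi fun p => evalPoly (p ∘ Sum.inl, fun j => -p (Sum.inr j))

theorem polyToFun_apply (f : PolyRing k m n) (p : Fin m ⊕ Fin n → k) :
    polyToFun k f p = evalPoly (p ∘ Sum.inl, fun j => -p (Sum.inr j)) f := rfl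

theorem polyToFun_C (c : k) (p : Fin m ⊕ Fin n → k) : polyToFun k (MvPolynomial.C c) p = c :=
  congrFun ((polyToFun k).commutes c) p

theorem polyToFun_X_inl (i : Fin m) (p : Fin m ⊕ Fin n → k) :
    polyToFun k (MvPolynomial.X (Sum.inl i)) p = p (Sum.inl i) := by
  simp [polyToFun_apply, evalPoly]

theorem polyToFun_X_inr (j : Fin n) (p : Fin m ⊕ Fin n → k) :
    polyToFun k (MvPolynomial.X (Sum.inr j)) p = -p (Sum.inr j) := by
  simp [polyToFun_apply, evalPoly]

theorem polyToFun_injective [Infinite k] : Injective (polyToFun k (m := m) (n := n)) := by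
  intro f g h
  refine MvPolynomial.funext fun x => ?_
  have h' := congrFun h (Sum.elim (x ∘ Sum.inl) fun j => -x (Sum.inr j))
  have hx : Sum.elim (x ∘ Sum.inl) (fun j => x (Sum.inr j)) = x := by
    ext v
    cases v <;> rfl
  simpa [polyToFun_apply, evalPoly, hx, MvPolynomial.aeval_eq_eval] using h'

theorem polyToFun_range :
    (polyToFun k (m := m) (n := n)).range = regular (affineLine k).gens (Fin m ⊕ Fin n) := by
  apply le_antisymm
  · rintro _ ⟨f, rfl⟩
    induction f using MvPolynomial.induction_on with
    | C c => exact (polyToFun k).commutes c ▸ Subalgebra.algebraMap_mem _ c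
    | add f g hf hg =>
      rw [map_add]
      exact add_mem hf hg
    | mul_X f v hf =>
      rw [map_mul]
      refine mul_mem hf ?_
      rcases v with i | j
      · convert (affineLine k).coord_mem (Sum.inl i) using 1
        ext p
        simp [polyToFun_apply, evalPoly, affineLine]
      · convert neg_mem ((affineLine k).coord_mem (Sum.inr j)) using 1
        ext p
        simp [polyToFun_apply, evalPoly, affineLine]
  · refine Algebra.adjoin_le ?_
    rintro _ ⟨i | j, r, rfl, rfl⟩
    · refine ⟨MvPolynomial.X (Sum.inl i), ?_⟩
      ext p
      simp [polyToFun_apply, evalPoly]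
    · refine ⟨-MvPolynomial.X (Sum.inr j), ?_⟩
      ext p
      simp [polyToFun_apply, evalPoly]

theorem polyToFun_rename (f : PolyRing k m n) (σ : Equiv.Perm (Fin m)) (τ : Equiv.Perm (Fin n))
    (p : Fin m ⊕ Fin n → k) :
    polyToFun k (MvPolynomial.rename (perm σ τ) f) p = polyToFun k f (p ∘ perm σ τ) := by
  rw [polyToFun_apply, polyToFun_apply, evalPoly, evalPoly, MvPolynomial.aeval_rename]
  congr 2
  ext v
  cases v <;> rfl

/-- The sign in `yⱼ = -t` cancels the sign built into `polyToFun`, so both variables receive the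
value `t`. -/
theorem polyToFun_eval_subst (f : PolyRing k m n) (i : Fin m) (j : Fin n) (t : k)
    (p : Fin m ⊕ Fin n → k) :
    polyToFun k ((subst k i j f).eval (MvPolynomial.C t)) p =
      polyToFun k f (LineModel.setPair i j t p) := by
  induction f using MvPolynomial.induction_on with
  | C c =>
    rw [show (MvPolynomial.C c : PolyRing k m n) = algebraMap k _ c from rfl, AlgHom.commutes,
      AlgHom.commutes]
    change polyToFun k (Polynomial.eval _ (Polynomial.C (MvPolynomial.C c))) p = _
    rw [Polynomial.eval_C]
    exact congrFun ((polyToFun k).commutes c) p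
  | add f g hf hg =>
    rw [map_add, Polynomial.eval_add, map_add, map_add, Pi.add_apply, Pi.add_apply, hf, hg]
  | mul_X f v hf =>
    rw [map_mul, Polynomial.eval_mul, map_mul, map_mul, Pi.mul_apply, Pi.mul_apply, hf]
    congr 1
    rcases v with a | b
    · rw [subst, MvPolynomial.aeval_X, Sum.elim_inl, polyToFun_X_inl]
      split_ifs with h
      · rw [Polynomial.eval_X, polyToFun_C, h]
        simp [LineModel.setPair]
      · rw [Polynomial.eval_C, polyToFun_X_inl]
        simp [LineModel.setPair, h]
    · rw [subst, MvPolynomial.aeval_X, Sum.elim_inr, polyToFun_X_inr]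
      split_ifs with h
      · rw [Polynomial.eval_neg, Polynomial.eval_X, map_neg, Pi.neg_apply, polyToFun_C, h]
        simp [LineModel.setPair]
      · rw [Polynomial.eval_C, polyToFun_X_inr]
        simp [LineModel.setPair, h]

theorem polyToFun_mem_superFun_iff [Infinite k] (f : PolyRing k m n) :
    polyToFun k f ∈ (affineLine k).superFun m n ↔ f ∈ superPoly k m n := by
  constructor
  · rintro ⟨-, h1, h2⟩
    refine ⟨fun σ τ => polyToFun_injective k (funext fun p => ?_), fun i j => ?_⟩
    · rw [polyToFun_rename, h1]
    · refine ⟨(subst k i j f).eval (MvPolynomial.C 0), ?_⟩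
      -- A polynomial in `t` that takes the same value at infinitely many constants is constant.
      refine Polynomial.eq_of_infinite_eval_eq _ _ (Set.infinite_of_injective_forall_mem
        (MvPolynomial.C_injective (Fin m ⊕ Fin n) k) fun t => ?_)
      change Polynomial.eval _ _ = Polynomial.eval _ _
      rw [Polynomial.eval_C]
      refine polyToFun_injective k (funext fun p => ?_)
      rw [polyToFun_eval_subst, polyToFun_eval_subst]
      refine h2 i j _ _ (by simp [LineModel.setPair]) (by simp [LineModel.setPair]) ?_
      intro v hi hj
      simp [LineModel.setPair, hi, hj]
  · rintro ⟨h1, h2⟩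
    refine ⟨polyToFun_range k (m := m) (n := n) ▸ ⟨f, rfl⟩, fun σ τ p => ?_,
      fun i j p q hp hq h => ?_⟩
    · rw [← polyToFun_rename, h1]
    · obtain ⟨g, hg⟩ := h2 i j
      rw [← LineModel.setPair_eq (p := p) hp fun _ _ _ => rfl, ← LineModel.setPair_eq hq h,
        ← polyToFun_eval_subst, ← polyToFun_eval_subst, hg, Polynomial.eval_C, Polynomial.eval_C]

theorem range_eq_superFun_of_mem_iff {X A : Type*} {L : LineModel k X} [CommRing A]
    [Algebra k A] {S : Subalgebra k A} {ι : A →ₐ[k] ((Fin m ⊕ Fin n → X) → k)}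
    (hr : ι.range = regular L.gens (Fin m ⊕ Fin n))
    (h : ∀ f, ι f ∈ L.superFun m n ↔ f ∈ S) : (ι.comp S.val).range = L.superFun m n := by
  ext f
  constructor
  · rintro ⟨g, rfl⟩
    exact (h _).2 g.2
  · intro hf
    obtain ⟨g, rfl⟩ : f ∈ ι.range := hr ▸ hf.1
    exact ⟨⟨g, (h g).1 hf⟩, rfl⟩

theorem superPoly_nullstellensatz [IsAlgClosed k] [CharZero k] (M : Ideal (superPoly k m n))
    [M.IsMaximal] : ∃ p : (Fin m → k) × (Fin n → k), ∀ f : superPoly k m n,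
      f ∈ M ↔ evalPoly p (f : PolyRing k m n) = 0 := by
  obtain ⟨p, hp⟩ := (affineLine k).exists_mem_iff_of_range_eq
    ((polyToFun k).comp (superPoly k m n).val)
    ((polyToFun_injective k).comp Subtype.val_injective)
    (range_eq_superFun_of_mem_iff k (polyToFun_range k) (polyToFun_mem_superFun_iff k)) M
  exact ⟨_, hp⟩

end Polynomial

/-! ### Case L: Laurent polynomials as functions on powers of the punctured line. -/

section Laurent

variable (k : Type*) [Field k] {m n : ℕ}

/-- The punctured affine line. -/
def puncturedLine : LineModel k kˣ where
  coord := Units.val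
  gens := {Units.val, fun x => ((x⁻¹ : kˣ) : k)}
  coord_injective := Units.val_injective
  coord_mem_gens := Or.inl rfl
  finite_gens := Set.toFinite _
  finite_zeros r hr x hx := by
    have h : ∃ (N : ℕ) (P : Polynomial k), ∀ x : kˣ, (x : k) ^ N * r x = P.eval (x : k) := by
      clear hx
      induction hr using Algebra.adjoin_induction with
      | mem f h =>
        rcases h with rfl | rfl
        · exact ⟨0, Polynomial.X, by simp⟩
        · exact ⟨1, 1, by simp⟩
      | algebraMap c => exact ⟨0, Polynomial.C c, by simp⟩
      | add f g _ _ hf hg =>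
        obtain ⟨N, P, hP⟩ := hf
        obtain ⟨N', Q, hQ⟩ := hg
        refine ⟨N + N', Polynomial.X ^ N' * P + Polynomial.X ^ N * Q, fun x => ?_⟩
        simp only [Pi.add_apply, Polynomial.eval_add, Polynomial.eval_mul, Polynomial.eval_pow,
          Polynomial.eval_X, ← hP, ← hQ]
        ring
      | mul f g _ _ hf hg =>
        obtain ⟨N, P, hP⟩ := hf
        obtain ⟨N', Q, hQ⟩ := hg
        refine ⟨N + N', P * Q, fun x => ?_⟩
        simp only [Pi.mul_apply, Polynomial.eval_mul, ← hP, ← hQ]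
        ring
    obtain ⟨N, P, hP⟩ := h
    have h0 : P ≠ 0 := by
      rintro rfl
      simpa [hx] using hP x
    refine ((Polynomial.finite_setOfPred_isRoot h0).preimage
      (Units.val_injective (α := k)).injOn).subset fun y hy => ?_
    have hy' : r y = 0 := hy
    change P.eval (y : k) = 0
    rw [← hP, hy', mul_zero]
  exists_point χ := by
    let a : Algebra.adjoin k {Units.val, fun x : kˣ => ((x⁻¹ : kˣ) : k)} :=
      ⟨Units.val, Algebra.subset_adjoin (Or.inl rfl)⟩
    let b : Algebra.adjoin k {Units.val, fun x : kˣ => ((x⁻¹ : kˣ) : k)} :=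
      ⟨fun x => ((x⁻¹ : kˣ) : k), Algebra.subset_adjoin (Or.inr rfl)⟩
    have hab : a * b = 1 := Subtype.ext (funext fun x => x.mul_inv)
    have hab' : χ a * χ b = 1 := by rw [← map_mul, hab, map_one]
    refine ⟨⟨χ a, χ b, hab', by rw [mul_comm, hab']⟩, ?_⟩
    rintro r (rfl | rfl) <;> rfl
  divided_difference := by
    rintro r (rfl | rfl)
    · exact ⟨1, one_mem _, by simp⟩
    · have h : ∀ b : Bool, (fun p : Bool → kˣ => (((p b)⁻¹ : kˣ) : k)) ∈
          regular {Units.val, fun x : kˣ => ((x⁻¹ : kˣ) : k)} Bool := fun b =>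
        Algebra.subset_adjoin ⟨b, _, Or.inr rfl, rfl⟩
      -- This is `1/x - 1/y = (x - y) * (-(1/x) * (1/y))`.
      refine ⟨_, neg_mem (mul_mem (h true) (h false)), fun x y => ?_⟩
      simp only [Pi.neg_apply, Pi.mul_apply, cond_true, cond_false, Units.val_inv_eq_inv_val]
      field_simp
      ring

variable {k}

/-- The value of the monomial with exponent `a` at a point. -/
def monomialVal {σ : Type*} [Fintype σ] (a : σ →₀ ℤ) : (σ → kˣ) →* k where
  toFun p := ((∏ v, p v ^ a v : kˣ) : k)
  map_one' := by simp
  map_mul' p q := by simp [mul_zpow, Finset.prod_mul_distrib]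

theorem monomialVal_apply {σ : Type*} [Fintype σ] (a : σ →₀ ℤ) (p : σ → kˣ) :
    monomialVal a p = ((∏ v, p v ^ a v : kˣ) : k) := rfl

theorem monomialVal_zero {σ : Type*} [Fintype σ] (p : σ → kˣ) :
    monomialVal (0 : σ →₀ ℤ) p = 1 := by
  simp [monomialVal_apply]

theorem monomialVal_add {σ : Type*} [Fintype σ] (a b : σ →₀ ℤ) (p : σ → kˣ) :
    monomialVal (a + b) p = monomialVal a p * monomialVal b p := by
  simp [monomialVal_apply, zpow_add, Finset.prod_mul_distrib]

variable (k)

theorem infinite_units [Infinite k] : Infinite kˣ := by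
  have : Infinite ↥(({0} : Set k)ᶜ) := (Set.finite_singleton _).infinite_compl.to_subtype
  exact Infinite.of_injective (fun x : ↥(({0} : Set k)ᶜ) => Units.mk0 x.1 x.2) fun x y h =>
    Subtype.ext (congrArg Units.val h)

theorem eq_zero_of_zpow_eq_one [Infinite k] {d : ℤ} (h : ∀ t : kˣ, t ^ d = 1) : d = 0 := by
  classical
  have := infinite_units k
  by_contra hd
  have hN : 0 < d.natAbs := Int.natAbs_pos.2 hd
  have hroot : ∀ t : kˣ, (t : k) ∈ (Polynomial.X ^ d.natAbs - Polynomial.C 1 : Polynomial k).roots.toFinset := by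
    intro t
    have ht : t ^ d.natAbs = 1 := by
      rcases Int.natAbs_eq d with e | e
      · rw [← zpow_natCast, ← e, h]
      · rw [← inv_inj, ← zpow_natCast, ← zpow_neg, ← e, h, inv_one]
    rw [Multiset.mem_toFinset, Polynomial.mem_roots (Polynomial.X_pow_sub_C_ne_zero hN 1),
      Polynomial.IsRoot.def]
    simp [← Units.val_pow_eq_pow_val, ht]
  exact not_injective_infinite_finite (fun t : kˣ => (⟨t, hroot t⟩ :
    (Polynomial.X ^ d.natAbs - Polynomial.C 1 : Polynomial k).roots.toFinset)) fun s t h =>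
      Units.ext (congrArg Subtype.val h)

theorem monomialVal_injective [Infinite k] {σ : Type*} [Fintype σ] :
    Injective (monomialVal (k := k) (σ := σ)) := by
  classical
  intro a b h
  ext v
  rw [← sub_eq_zero]
  refine eq_zero_of_zpow_eq_one k fun t => ?_
  have h' := Units.ext (DFunLike.congr_fun h (Pi.mulSingle v t))
  have key : ∀ c : σ →₀ ℤ, ∏ w, (Pi.mulSingle v t : σ → kˣ) w ^ c w = t ^ c v := by
    intro c
    rw [Finset.prod_eq_single v (fun w _ hw => by simp [hw]) (by simp)]
    simp
  rw [key, key] at h'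
  rw [zpow_sub, h', mul_inv_cancel]

/-- A linear combination of distinct characters vanishes only if all coefficients do. -/
theorem eq_zero_of_sum_characters {M G : Type*} [Monoid G] {φ : M → (G →* k)} (hφ : Injective φ)
    (f : AddMonoidAlgebra k M) (h : ∀ g, (f.coeff.sum fun a c => c * φ a g) = 0) : f = 0 := by
  have hli := (linearIndependent_monoidHom G k).comp φ hφ
  have : f.coeff = 0 := by
    refine linearIndependent_iff.1 hli _ (funext fun g => ?_)
    rw [Finsupp.linearCombination_apply, Finsupp.sum, Finset.sum_apply]
    exact h g
  exact AddMonoidAlgebra.coeff_injective this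

/-- A Laurent polynomial as a function. -/
noncomputable def laurentToFun : LaurentRing k m n →ₐ[k] ((Fin m ⊕ Fin n → kˣ) → k) :=
  AlgHom.pi fun p => evalLaurent (p ∘ Sum.inl, p ∘ Sum.inr)

theorem laurentToFun_single (a : Fin m ⊕ Fin n →₀ ℤ) (c : k) (p : Fin m ⊕ Fin n → kˣ) :
    laurentToFun k (AddMonoidAlgebra.single a c) p = c * monomialVal a p := by
  change evalLaurent _ _ = _
  rw [evalLaurent, AddMonoidAlgebra.lift_single, smul_eq_mul]
  congr 1
  change ((∏ v, Sum.elim (p ∘ Sum.inl) (p ∘ Sum.inr) v ^ a v : kˣ) : k) = _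
  rw [Sum.elim_comp_inl_inr]
  rfl

theorem laurentToFun_apply (f : LaurentRing k m n) (p : Fin m ⊕ Fin n → kˣ) :
    laurentToFun k f p = f.coeff.sum fun a c => c * monomialVal a p := by
  induction f using AddMonoidAlgebra.induction_linear with
  | zero => simp
  | add f g hf hg =>
    rw [map_add, Pi.add_apply, hf, hg, AddMonoidAlgebra.coeff_add]
    exact (Finsupp.sum_add_index' (fun _ => zero_mul _) (fun _ _ _ => add_mul _ _ _)).symm
  | single a c =>
    rw [laurentToFun_single, AddMonoidAlgebra.coeff_single,
      Finsupp.sum_single_index (zero_mul _)]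

theorem laurentToFun_injective [Infinite k] : Injective (laurentToFun k (m := m) (n := n)) := by
  rw [injective_iff_map_eq_zero]
  intro f hf
  refine eq_zero_of_sum_characters k (monomialVal_injective k) f fun p => ?_
  rw [← laurentToFun_apply, hf]
  rfl

theorem laurentToFun_range :
    (laurentToFun k (m := m) (n := n)).range =
      regular (puncturedLine k).gens (Fin m ⊕ Fin n) := by
  apply le_antisymm
  · rintro _ ⟨f, rfl⟩
    induction f using AddMonoidAlgebra.induction_linear with
    | zero => exact map_zero (laurentToFun k) ▸ zero_mem _
    | add f g hf hg =>
      change laurentToFun k (f + g) ∈ _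
      rw [map_add]
      exact add_mem hf hg
    | single a c =>
      have h : laurentToFun k (AddMonoidAlgebra.single a c) =
          fun p => c * ∏ v, (((p v ^ a v : kˣ)) : k) := by
        ext p
        rw [laurentToFun_single, monomialVal_apply, Units.coe_prod]
      change laurentToFun k (AddMonoidAlgebra.single a c) ∈ _
      rw [h]
      refine mul_mem ((puncturedLine k).const_mem c) ((puncturedLine k).prod_mem _ fun v _ => ?_)
      rcases Int.eq_nat_or_neg (a v) with ⟨N, h | h⟩
      · convert pow_mem ((puncturedLine k).gen_mem (Or.inl rfl) v) N using 1
        ext p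
        simp [h]
      · convert pow_mem ((puncturedLine k).gen_mem (Or.inr rfl) v) N using 1
        ext p
        simp [h]
  · have key : ∀ (v : Fin m ⊕ Fin n) (d : ℤ), (fun p : Fin m ⊕ Fin n → kˣ => ((p v ^ d : kˣ) : k)) =
        laurentToFun k (AddMonoidAlgebra.single (Finsupp.single v d) 1) := by
      intro v d
      ext p
      rw [laurentToFun_single, one_mul, monomialVal_apply,
        Finset.prod_eq_single v (fun w _ hw => by simp [Finsupp.single_eq_of_ne hw]) (by simp)]
      simp
    refine Algebra.adjoin_le ?_
    rintro _ ⟨v, r, rfl | rfl, rfl⟩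
    · exact ⟨_, (key v 1).symm.trans (by simp)⟩
    · exact ⟨_, (key v (-1)).symm.trans (by simp)⟩

theorem laurentToFun_perm (f : LaurentRing k m n) (σ : Equiv.Perm (Fin m)) (τ : Equiv.Perm (Fin n))
    (p : Fin m ⊕ Fin n → kˣ) :
    laurentToFun k (laurentPerm k σ τ f) p = laurentToFun k f (p ∘ perm σ τ) := by
  induction f using AddMonoidAlgebra.induction_linear with
  | zero => simp
  | add f g hf hg => rw [map_add, map_add, map_add, Pi.add_apply, Pi.add_apply, hf, hg]
  | single a c =>
    have h : laurentPerm k σ τ (AddMonoidAlgebra.single a c) =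
        AddMonoidAlgebra.single (a.mapDomain (perm σ τ)) c :=
      AddMonoidAlgebra.mapDomain_single
    rw [h, laurentToFun_single, laurentToFun_single, monomialVal_apply, monomialVal_apply]
    congr 2
    refine (Fintype.prod_equiv (Equiv.sumCongr σ τ) _ _ fun v => ?_).symm
    change p (perm σ τ v) ^ a v = p (perm σ τ v) ^ (a.mapDomain (perm σ τ)) (perm σ τ v)
    have hinj : Injective (perm σ τ) := Sum.map_injective.2 ⟨σ.injective, τ.injective⟩
    rw [Finsupp.mapDomain_apply hinj]

variable {k}

/-- The restriction of a Laurent polynomial to the curve on which the variables `xᵢ` and `yⱼ` are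
equal and the other variables are constant. -/
noncomputable def restrictPair (i : Fin m) (j : Fin n) (p : Fin m ⊕ Fin n → kˣ) :
    LaurentRing k m n →ₐ[k] AddMonoidAlgebra k ℤ :=
  AddMonoidAlgebra.lift k _ _
    { toFun := fun a => AddMonoidAlgebra.single
        (a.toAdd (Sum.inl i) + a.toAdd (Sum.inr j))
        (monomialVal a.toAdd (LineModel.setPair i j 1 p))
      map_one' := by
        rw [toAdd_one, monomialVal_zero]
        rfl
      map_mul' := fun a b => by
        rw [AddMonoidAlgebra.single_mul_single, toAdd_mul, monomialVal_add, Finsupp.add_apply,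
          Finsupp.add_apply, add_add_add_comm] }

theorem restrictPair_single (i : Fin m) (j : Fin n) (p : Fin m ⊕ Fin n → kˣ)
    (a : Fin m ⊕ Fin n →₀ ℤ) (c : k) :
    restrictPair i j p (AddMonoidAlgebra.single a c) =
      AddMonoidAlgebra.single (a (Sum.inl i) + a (Sum.inr j))
        (c * monomialVal a (LineModel.setPair i j 1 p)) := by
  rw [restrictPair, AddMonoidAlgebra.lift_single]
  exact AddMonoidAlgebra.smul_single _ _ _

/-- On the curve `xᵢ = yⱼ = t` the sum of the two Euler operators becomes `t d/dt`, which multiplies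
`t ^ d` by `d`. -/
theorem restrictPair_euler (i : Fin m) (j : Fin n) (p : Fin m ⊕ Fin n → kˣ)
    (f : LaurentRing k m n) (d : ℤ) :
    (restrictPair i j p (euler k (Sum.inl i) f + euler k (Sum.inr j) f)).coeff d =
      d * (restrictPair i j p f).coeff d := by
  induction f using AddMonoidAlgebra.induction_linear with
  | zero => simp
  | add f g hf hg =>
    rw [map_add (euler k _), map_add (euler k _), add_add_add_comm, map_add, map_add (restrictPair i j p) f g,
      AddMonoidAlgebra.coeff_add, AddMonoidAlgebra.coeff_add, Finsupp.add_apply, Finsupp.add_apply,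
      hf, hg, mul_add]
  | single a c =>
    change (restrictPair i j p (eulerLin k (Sum.inl i) _ + eulerLin k (Sum.inr j) _)).coeff d = _
    rw [eulerLin_single, eulerLin_single, ← AddMonoidAlgebra.single_add, restrictPair_single,
      restrictPair_single, AddMonoidAlgebra.coeff_single, AddMonoidAlgebra.coeff_single,
      Finsupp.single_apply, Finsupp.single_apply]
    split_ifs with h
    · rw [← h]
      push_cast
      ring
    · simp

theorem monomialVal_setPair (i : Fin m) (j : Fin n) (t : kˣ) (p : Fin m ⊕ Fin n → kˣ)
    (a : Fin m ⊕ Fin n →₀ ℤ) : (monomialVal a (LineModel.setPair i j t p) : k) =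
      ((t ^ (a (Sum.inl i) + a (Sum.inr j)) : kˣ) : k) *
        monomialVal a (LineModel.setPair i j 1 p) := by
  have h : LineModel.setPair i j t p =
      Pi.mulSingle (Sum.inl i) t * Pi.mulSingle (Sum.inr j) t * LineModel.setPair i j 1 p := by
    ext v
    rcases v with b | b
    · by_cases hb : b = i <;> simp [LineModel.setPair, hb]
    · by_cases hb : b = j <;> simp [LineModel.setPair, hb]
  have key : ∀ v, monomialVal a (Pi.mulSingle v t : Fin m ⊕ Fin n → kˣ) =
      ((t ^ a v : kˣ) : k) := by
    intro v
    rw [monomialVal_apply, Finset.prod_eq_single v (fun w _ hw => by simp [hw]) (by simp)]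
    simp
  rw [h, map_mul, map_mul, key, key, zpow_add, Units.val_mul]

theorem sum_restrictPair (i : Fin m) (j : Fin n) (t : kˣ) (p : Fin m ⊕ Fin n → kˣ)
    (f : LaurentRing k m n) :
    ((restrictPair i j p f).coeff.sum fun d c => c * ((t ^ d : kˣ) : k)) =
      laurentToFun k f (LineModel.setPair i j t p) := by
  induction f using AddMonoidAlgebra.induction_linear with
  | zero => simp
  | add f g hf hg =>
    rw [map_add, map_add, AddMonoidAlgebra.coeff_add, Pi.add_apply, ← hf, ← hg]
    exact Finsupp.sum_add_index' (fun _ => zero_mul _) (fun _ _ _ => add_mul _ _ _)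
  | single a c =>
    rw [restrictPair_single, laurentToFun_single, AddMonoidAlgebra.coeff_single,
      monomialVal_setPair i j t]
    refine (Finsupp.sum_single_index (by simp)).trans ?_
    ring

theorem eq_zero_of_sum_zpow [Infinite k] (f : AddMonoidAlgebra k ℤ)
    (h : ∀ t : kˣ, (f.coeff.sum fun d c => c * ((t ^ d : kˣ) : k)) = 0) : f = 0 := by
  refine eq_zero_of_sum_characters k (G := kˣ)
    (φ := fun d => (Units.coeHom k).comp (zpowGroupHom d)) (fun d e hde => ?_) f h
  rw [← sub_eq_zero]
  refine eq_zero_of_zpow_eq_one k fun t => ?_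
  have : t ^ d = t ^ e := Units.ext (DFunLike.congr_fun hde t)
  rw [zpow_sub, this, mul_inv_cancel]

/-- The differential condition for a pair of variables says that the Laurent polynomial does not
depend on the common value of the two variables. -/
theorem euler_mem_span_iff [Infinite k] [CharZero k] (f : LaurentRing k m n) (i : Fin m)
    (j : Fin n) :
    euler k (Sum.inl i) f + euler k (Sum.inr j) f ∈
        Ideal.span {laurentVar k (Sum.inl i) - laurentVar k (Sum.inr j)} ↔
      ∀ p t u, laurentToFun k f (LineModel.setPair i j t p) =
        laurentToFun k f (LineModel.setPair i j u p) := by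
  have hvar : ∀ (v : Fin m ⊕ Fin n) (p : Fin m ⊕ Fin n → kˣ),
      laurentToFun k (laurentVar k v) p = p v := by
    intro v p
    rw [laurentVar, laurentToFun_single, one_mul, monomialVal_apply,
      Finset.prod_eq_single v (fun w _ hw => by simp [Finsupp.single_eq_of_ne hw]) (by simp)]
    simp
  constructor
  · intro h p t u
    obtain ⟨g, hg⟩ := Ideal.mem_span_singleton'.1 h
    have h0 : restrictPair i j p (euler k (Sum.inl i) f + euler k (Sum.inr j) f) = 0 := by
      refine eq_zero_of_sum_zpow _ fun t => ?_
      rw [sum_restrictPair, ← hg, map_mul, map_sub, Pi.mul_apply, Pi.sub_apply, hvar, hvar]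
      simp [LineModel.setPair]
    -- In characteristic zero the kernel of `t d/dt` consists of the constants.
    have hc : ∀ d ≠ 0, (restrictPair i j p f).coeff d = 0 := by
      intro d hd
      have := restrictPair_euler i j p f d
      rw [h0] at this
      exact (mul_eq_zero.1 this.symm).resolve_left (Int.cast_ne_zero.2 hd)
    rw [← sum_restrictPair, ← sum_restrictPair]
    refine Finset.sum_congr rfl fun d hd => ?_
    have : d = 0 := by
      by_contra h
      exact Finsupp.mem_support_iff.1 hd (hc d h)
    simp [this]
  · intro h
    have hD : ∀ p : Fin m ⊕ Fin n → kˣ, p (Sum.inl i) = p (Sum.inr j) →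
        laurentToFun k (euler k (Sum.inl i) f + euler k (Sum.inr j) f) p = 0 := by
      intro p hp
      set c := laurentToFun k f (LineModel.setPair i j 1 p)
      -- Both Euler operators kill constants, so subtracting the constant value `c` makes the
      -- restriction zero without changing the derivative.
      have h0 : restrictPair i j p (f - algebraMap k _ c) = 0 := by
        refine eq_zero_of_sum_zpow _ fun t => ?_
        rw [sum_restrictPair, map_sub, Pi.sub_apply, h p t 1, AlgHom.commutes]
        exact sub_self c
      have h1 : restrictPair i j p (euler k (Sum.inl i) f + euler k (Sum.inr j) f) = 0 := by
        refine AddMonoidAlgebra.coeff_injective (Finsupp.ext fun d => ?_)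
        have := restrictPair_euler i j p (f - algebraMap k _ c) d
        rw [map_sub, map_sub, Derivation.map_algebraMap, Derivation.map_algebraMap, sub_zero,
          sub_zero, h0] at this
        rw [this]
        simp
      rw [← LineModel.setPair_eq (p := p) hp fun _ _ _ => rfl, ← sum_restrictPair, h1]
      simp
    -- Membership in the ideal is divisibility by `xᵢ - yⱼ`. The quotient is found among regular
    -- functions, all of which come from Laurent polynomials.
    obtain ⟨g, hg, hDg⟩ := (puncturedLine k).exists_eq_diff_mul
      (laurentToFun_range k (m := m) (n := n) ▸ ⟨_, rfl⟩) _ _ hD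
    obtain ⟨g, rfl⟩ : g ∈ (laurentToFun k).range := laurentToFun_range k (m := m) (n := n) ▸ hg
    refine Ideal.mem_span_singleton'.2 ⟨g, laurentToFun_injective k (funext fun p => ?_)⟩
    rw [hDg, map_mul, map_sub, Pi.mul_apply, Pi.sub_apply, hvar, hvar, mul_comm]
    rfl

variable (k)

theorem laurentToFun_mem_superFun_iff [Infinite k] [CharZero k] (f : LaurentRing k m n) :
    laurentToFun k f ∈ (puncturedLine k).superFun m n ↔ f ∈ superLaurent k m n := by
  constructor
  · rintro ⟨-, h1, h2⟩
    refine ⟨fun σ τ => laurentToFun_injective k (funext fun p => ?_), fun i j => ?_⟩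
    · rw [laurentToFun_perm, h1]
    · refine (euler_mem_span_iff f i j).2 fun p t u => h2 i j _ _ (by simp [LineModel.setPair])
        (by simp [LineModel.setPair]) ?_
      intro v hi hj
      simp [LineModel.setPair, hi, hj]
  · rintro ⟨h1, h2⟩
    refine ⟨laurentToFun_range k (m := m) (n := n) ▸ ⟨f, rfl⟩, fun σ τ p => ?_,
      fun i j p q hp hq h => ?_⟩
    · rw [← laurentToFun_perm, h1]
    · rw [← LineModel.setPair_eq (p := p) hp fun _ _ _ => rfl, ← LineModel.setPair_eq hq h]
      exact (euler_mem_span_iff f i j).1 (h2 i j) _ _ _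

theorem superLaurent_nullstellensatz [IsAlgClosed k] [CharZero k] (M : Ideal (superLaurent k m n))
    [M.IsMaximal] : ∃ p : (Fin m → kˣ) × (Fin n → kˣ), ∀ f : superLaurent k m n,
      f ∈ M ↔ evalLaurent p (f : LaurentRing k m n) = 0 := by
  have := infinite_units k
  obtain ⟨p, hp⟩ := (puncturedLine k).exists_mem_iff_of_range_eq
    ((laurentToFun k).comp (superLaurent k m n).val)
    ((laurentToFun_injective k).comp Subtype.val_injective)
    (range_eq_superFun_of_mem_iff k (laurentToFun_range k) (laurentToFun_mem_superFun_iff k)) M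
  exact ⟨_, hp⟩

end Laurent

end Supersymmetric

theorem theorem6p1 (k : Type*) [Field k] [IsAlgClosed k] [CharZero k] (m n : ℕ) :
    (∀ M : Ideal (Supersymmetric.superPoly k m n), M.IsMaximal →
      ∃ p : (Fin m → k) × (Fin n → k),
        ∀ f : Supersymmetric.superPoly k m n,
          f ∈ M ↔ Supersymmetric.evalPoly p (f : Supersymmetric.PolyRing k m n) = 0) ∧
    (∀ M : Ideal (Supersymmetric.superLaurent k m n), M.IsMaximal →
      ∃ p : (Fin m → kˣ) × (Fin n → kˣ),
        ∀ f : Supersymmetric.superLaurent k m n,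
          f ∈ M ↔ Supersymmetric.evalLaurent p (f : Supersymmetric.LaurentRing k m n) = 0) := by
  exact ⟨fun M hM => Supersymmetric.superPoly_nullstellensatz k M,
    fun M hM => Supersymmetric.superLaurent_nullstellensatz k M⟩
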